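/- **Setting.** Let $E$ be a finite set with a connected symmetric neighbourhood structure $(S_x)_{x\in E}$ (loops allowed), $\mu_0$ a probability on $E$, and $q_0$ a transition probability on $E$ that is irreducible ($\sum_n q_0^{(n)}(x,y)=\infty$ for all $x,y$), $\mu_0$-reversible, satisfies $q_0(x,S_x)=1$ for all $x$, and satisfies $q_0(x,y)>0$ for $y\in S_x$. For $x\in E$ let $P_x$ be a probability on a measurable space $\Omega$ and let $U(x,\cdot):\Omega\to[0,\infty]$ be measurable. Let $E'\subset E$ and $M>0$ be such that $0\le U(x,\omega)\le M$ for $x\in E'$ and $U(x,\omega)=\infty$ for $x\notin E'$, for all $\omega$, and such that $\mu_0(x)>0$ for $x\in E'$. For $x,y\in E$ let $Q_{x,y}$ be a probability on $\Omega\times\Omega$ with marginals $P_x$ and $P_y$ (the product $P_x\otimes P_y$ if the simulation conditions at the current point and at the candidate are drawn independently; the diagonal law if the same condition is used at both). Put $J(x)=\int U(x,\omega)\,P_x(d\omega)$, $J^\star=\min_E J$, $\chi_\epsilon=\{x: J(x)\le J^\star+\epsilon\}$ and $\chi_\epsilon^c=E\setminus\chi_\epsilon$. Throughout $e^{-\beta\cdot\infty}=0$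 for all $\beta\ge 0$, and $[a]_+=\max(a,0)$ with $[\infty-\infty]_+=0$ (a case that never occurs from a state of $E'$). Let $H_{x,y}$ be the minimum, over all paths $x=x_0,\dots,x_n=y$ with $x_{i+1}\in S_{x_i}$, of $\max_i J(x_i)$, and let $m^\star=\max_{x,y\in E'}\{H_{x,y}-\max(J(x),J(y))\}\in[0,\infty]$. Let $\mu_\beta(x)=\mu_0(x)e^{-\beta J(x)}/\sum_z\mu_0(z)e^{-\beta J(z)}$ be the Gibbs measure of $J$, let $L_\beta\phi(x)=\sum_{y\neq x}(\phi(y)-\phi(x))\,q_0(x,y)\,e^{-\beta[J(y)-J(x)]_+}$, and let $\gamma(\beta)=\inf\{-\int\phi L_\beta\phi\,d\mu_\beta:\ \int\phi^2d\mu_\beta=1,\ \int\phi\,d\mu_\beta=0\}$. **Process.** Let $b,d>0$, $\alpha\in\mathbb R$, $\beta_t=b\log(td+1)$, $n_t=(t+1)^\alpha$. For $x\ne y$ let $$\tilde q_t(x,y)=q_0(x,y)\,\mathbb E\Big[\exp\Big(-\beta_t\Big[\tfrac1N\sum_{i=1}^N U(y,\tilde\omega_i)-\tfrac1N\sum_{i=1}^N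 U(x,\omega_i)\Big]_+\Big)\Big],$$ where $N-1$ is Poisson of parameter $n_t$ and, given $N$, the pairs $(\omega_i,\tilde\omega_i)$ are i.i.d. with law $Q_{x,y}$; let $\tilde q_t(x,x)=1-\sum_{y\neq x}\tilde q_t(x,y)$. Let $(\tilde\chi_k,T_k)_{k\ge0}$ be a Markov chain on $E\times\mathbb R_+$ with $\tilde\chi_0\in E'$ and $T_0=0$ almost surely and $$\Pr(\tilde\chi_{k+1}=y,\ T_{k+1}\ge u\mid \tilde\chi_0,T_0,\dots,\tilde\chi_k,T_k)=\int_u^\infty \tilde q_\tau(\tilde\chi_k,y)\,\mathbf 1_{\tau\ge T_k}\,e^{-(\tau-T_k)}\,d\tau ,$$ and let $\tilde X_t=\tilde\chi_k$ for $T_k\le t<T_{k+1}$. **Theorem.** Suppose that either (i) $m^\star b<\min(1,\alpha/2)$, or (ii) $m^\star b=1$, $\alpha>2$ and $d<2cm^\star/M$ for some constant $c$ such that $\gamma(\beta)\ge c\,e^{-m^\star\beta}$ for all $\beta\ge0$. Then there is $C>0$ such that for all $t\ge0$ and all $\epsilon>0$, $$\Pr(\tilde X_t\in\chi_\epsilon^c)\le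 C\,\mu_{\beta_t}(\chi_\epsilon^c)^{1/2},$$ and the same bound holds with $\mu_{\beta_t}$ replaced by the unweighted Gibbs measure $e^{-\beta_tJ(x)}/\sum_z e^{-\beta_tJ(z)}$. -/

import Mathlib

open MeasureTheory ProbabilityTheory
open scoped ENNReal NNReal

noncomputable section

namespace NoisyAnnealing

/-- The number `e^{-β s}` for `β ≥ 0` and `s ∈ [0, ∞]`, with `e^{-β·∞} = 0` for every `β`. -/
def boltz (β : ℝ) (s : ℝ≥0∞) : ℝ :=
  if s = ⊤ then 0 else Real.exp (-(β * s.toReal))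

/-- The standing setting: a finite state space with a connected neighbourhood structure
(loops are allowed), a proposal kernel with its reversible law, and a noisy cost. -/
structure Setting (E Ω : Type*) [Fintype E] [DecidableEq E] [MeasurableSpace Ω] where
  /-- the set of direct neighbours of a point -/
  S : E → Set E
  S_symm : ∀ x y, y ∈ S x → x ∈ S y
  S_connected : ∀ x y, Relation.ReflTransGen (fun a c => c ∈ S a) x y
  /-- the subset of states with finite cost -/
  E' : Set E
  /-- the reference probability -/
  μ₀ : E → ℝ
  μ₀_nonneg : ∀ x, 0 ≤ μ₀ x
  μ₀_sum : ∑ x, μ₀ x = 1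
  μ₀_pos : ∀ x ∈ E', 0 < μ₀ x
  /-- the proposal kernel -/
  q₀ : Matrix E E ℝ
  q₀_nonneg : ∀ x y, 0 ≤ q₀ x y
  q₀_sum : ∀ x, ∑ y, q₀ x y = 1
  q₀_irreducible : ∀ x y, ¬ Summable (fun n : ℕ => (q₀ ^ n) x y)
  q₀_reversible : ∀ x y, μ₀ x * q₀ x y = μ₀ y * q₀ y x
  q₀_neighbours : ∀ x, ∑ y, (S x).indicator (q₀ x) y = 1
  /-- every neighbour can be proposed -/
  q₀_pos : ∀ x, ∀ y ∈ S x, 0 < q₀ x y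
  /-- the law of the simulation condition at a point -/
  P : E → Measure Ω
  P_prob : ∀ x, IsProbabilityMeasure (P x)
  /-- the joint law of the pair of simulation conditions used to compare the current point `x`
  with the candidate `y`: the product law if the two are drawn independently, the diagonal law
  if the same condition is used at both points -/
  Q : E → E → Measure (Ω × Ω)
  Q_fst : ∀ x y, (Q x y).map Prod.fst = P x
  Q_snd : ∀ x y, (Q x y).map Prod.snd = P y
  /-- the noisy cost -/
  U : E → Ω → ℝ≥0∞
  U_meas : ∀ x, Measurable (U x)
  /-- the bound of the cost on `E'` -/
  M : ℝ
  M_pos : 0 < M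
  U_le : ∀ x ∈ E', ∀ ω, U x ω ≤ ENNReal.ofReal M
  U_top : ∀ x ∉ E', ∀ ω, U x ω = ⊤

namespace Setting

variable {E Ω : Type*} [Fintype E] [DecidableEq E] [MeasurableSpace Ω] (𝒮 : Setting E Ω)

/-- The mean cost `J(x) = E U(x, ω)`. -/
def J (x : E) : ℝ≥0∞ := ∫⁻ ω, 𝒮.U x ω ∂(𝒮.P x)

/-- The set of `ε`-optimal points. -/
def optimalSet (ε : ℝ) : Set E := {x | 𝒮.J x ≤ (⨅ y, 𝒮.J y) + ENNReal.ofReal ε}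

/-- `p 0 = x, p 1, …, p n = y` is a path of neighbours. -/
def IsPath (x y : E) (n : ℕ) (p : ℕ → E) : Prop :=
  p 0 = x ∧ p n = y ∧ ∀ i < n, p (i + 1) ∈ 𝒮.S (p i)

/-- The elevation of the cheapest path from `x` to `y`. -/
def elevation (x y : E) : ℝ≥0∞ :=
  ⨅ (n : ℕ) (p : ℕ → E) (_ : 𝒮.IsPath x y n p), ⨆ (i : ℕ) (_ : i ≤ n), 𝒮.J (p i)

/-- The maximal depth `m⋆` of a well; it is infinite if `E'` is not connected. -/
def mStar : ℝ≥0∞ :=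
  ⨆ x ∈ 𝒮.E', ⨆ y ∈ 𝒮.E', (𝒮.elevation x y - max (𝒮.J x) (𝒮.J y))

/-- The Gibbs distribution of `J` at inverse temperature `β` with reference weights `w`. -/
def gibbs (w : E → ℝ) (β : ℝ) (x : E) : ℝ :=
  w x * boltz β (𝒮.J x) / ∑ z, w z * boltz β (𝒮.J z)

/-- The Gibbs mass of a set. -/
def gibbsMass (w : E → ℝ) (β : ℝ) (A : Set E) : ℝ :=
  ∑ x, A.indicator (𝒮.gibbs w β) x

/-- The transition matrix of noise-free annealing. The truncated subtraction of `[0, ∞]` is the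
positive part of the difference. -/
def q (β : ℝ) (x y : E) : ℝ :=
  if y = x then
    1 - ∑ z ∈ Finset.univ.erase x, 𝒮.q₀ x z * boltz β (𝒮.J z - 𝒮.J x)
  else 𝒮.q₀ x y * boltz β (𝒮.J y - 𝒮.J x)

/-- The generator of noise-free annealing. -/
def L (β : ℝ) (φ : E → ℝ) (x : E) : ℝ := ∑ y, (φ y - φ x) * 𝒮.q β x y

/-- The spectral gap of `-L β` in `L²` of the Gibbs distribution. -/
def gap (β : ℝ) : ℝ :=
  sInf {r | ∃ φ : E → ℝ, ∑ x, φ x ^ 2 * 𝒮.gibbs 𝒮.μ₀ β x = 1 ∧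
    ∑ x, φ x * 𝒮.gibbs 𝒮.μ₀ β x = 0 ∧
    r = -∑ x, φ x * 𝒮.L β φ x * 𝒮.gibbs 𝒮.μ₀ β x}

/-- The probability of accepting the candidate `y` from `x`, with mini-batches of
`N = H + 1` samples, `H` Poisson of parameter `r`. -/
def accept (β : ℝ) (r : ℝ≥0) (x y : E) : ℝ :=
  ∫ n : ℕ, (∫ ω : Fin (n + 1) → Ω × Ω,
      boltz β ((∑ i, 𝒮.U y (ω i).2) / ((n + 1 : ℕ) : ℝ≥0∞)
        - (∑ i, 𝒮.U x (ω i).1) / ((n + 1 : ℕ) : ℝ≥0∞))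
      ∂(Measure.pi fun _ => 𝒮.Q x y)) ∂(poissonMeasure r)

/-- The transition matrix of noisy annealing. -/
def qTilde (β : ℝ) (r : ℝ≥0) (x y : E) : ℝ :=
  if y = x then 1 - ∑ z ∈ Finset.univ.erase x, 𝒮.q₀ x z * 𝒮.accept β r x z
  else 𝒮.q₀ x y * 𝒮.accept β r x y

end Setting

/-- The inverse temperature `β_t = b log (t d + 1)`. -/
def cooling (b d t : ℝ) : ℝ := b * Real.log (t * d + 1)

/-- The sampling intensity `n_t = (t + 1)^α`. -/
def intensity (α t : ℝ) : ℝ≥0 := Real.toNNReal ((t + 1) ^ α)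

/-- The information `σ((χ_j, T_j), j ≤ k)`. -/
abbrev past {E Ω' : Type*} (χ : ℕ → Ω' → E) (T : ℕ → Ω' → ℝ) (k : ℕ) : MeasurableSpace Ω' :=
  ⨆ (j : ℕ) (_ : j ≤ k),
    (MeasurableSpace.comap (χ j) ⊤ ⊔ MeasurableSpace.comap (T j) inferInstance)

/-- `X` is the continuous-time noisy annealing process started in `E'`, with states `χ` and
jump times `T`: `(χ_k, T_k)` is the Markov chain with
`P(χ_{k+1} = y, T_{k+1} ≥ u | past) = ∫_u^∞ q̃_τ(χ_k, y) 1_{τ ≥ T_k} e^{-(τ - T_k)} dτ`,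
and `X_t = χ_k` on `T_k ≤ t < T_{k+1}`. -/
structure IsNSA {E Ω : Type*} [Fintype E] [DecidableEq E] [MeasurableSpace Ω]
    (𝒮 : Setting E Ω) (b d α : ℝ) {Ω' : Type*} [MeasurableSpace Ω'] (Pr : Measure Ω')
    (χ : ℕ → Ω' → E) (T : ℕ → Ω' → ℝ) (X : ℝ → Ω' → E) : Prop where
  measurable_state : ∀ k y, MeasurableSet {ω | χ k ω = y}
  measurable_time : ∀ k, Measurable (T k)
  start_mem : ∀ᵐ ω ∂Pr, χ 0 ω ∈ 𝒮.E'
  start_time : ∀ᵐ ω ∂Pr, T 0 ω = 0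
  markov : ∀ (k : ℕ) (A : Set Ω'), MeasurableSet[past χ T k] A → ∀ (y : E) (u : ℝ), 0 ≤ u →
    Pr (A ∩ {ω | χ (k + 1) ω = y ∧ u ≤ T (k + 1) ω}) =
      ∫⁻ ω in A, (∫⁻ τ in Set.Ici u ∩ Set.Ici (T k ω),
        ENNReal.ofReal (𝒮.qTilde (cooling b d τ) (intensity α τ) (χ k ω) y
          * Real.exp (-(τ - T k ω)))) ∂Pr
  process : ∀ᵐ ω ∂Pr, ∀ t : ℝ, 0 ≤ t → ∀ k, T k ω ≤ t → t < T (k + 1) ω → X t ω = χ k ω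

end NoisyAnnealing

end

/-! ### The Dirichlet form of noise-free annealing and its Poincaré inequality. -/

namespace NoisyAnnealing

open Filter Topology

/-! Let `m_t` be the law of the process at time `t`, `f_t = m_t / μ_{β_t}` its density and `u_t = ∫
f_t² dμ_{β_t}`. By Cauchy-Schwarz, the mass that `m_t` gives to `A` is `∫_A f_t dμ_{β_t} ≤ u_t^{1/2}
μ_{β_t}(A)^{1/2}` (`sum_indicator_le_sqrt_mul_sqrt`), so it is enough that `u_t` stays bounded.

The law solves the forward equation `m' = m (q̃_t - 1)` (`IsJumpChain.hasDerivAt_law`).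
Differentiating `u_t` produces three terms (`deriv_secondMoment_le`): minus twice the noise-free
Dirichlet form of `f_t`; a cooling term at most `M β_t' u_t`, because the Gibbs weights move; and a
noise term at most `4 η_t u_t`, where `η_t` bounds the relative error of the noisy acceptance
probability.

The Dirichlet form is at least `c e^{-m⋆ β_t} (u_t - 1)`. In case (i) a constant `c > 0` comes from
the path method (`exists_poincareBound`); in case (ii) it is supplied by the spectral gap
(`poincareBound_of_le_gap`). Hoeffding's lemma for the batch mean, and a Chernoff bound for the
Poisson batch size, show that `η_t` is of order at most `t^{-α/2} log t` (`abs_accept_sub_le`). The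
error has to be relative: the perturbation is then dominated by `η_t` times a symmetric kernel,
whose column sums are as small as its row sums.

With `v = t d + 1` the gap decays like `v^{-m⋆ b}`, the cooling like `b d M / v` and the noise like
`v^{-α/2} log v`. The gap wins when `m⋆ b < min(1, α/2)`. At `m⋆ b = 1` gap and cooling have the
same order and the constants decide: `b d M < 2c`. Then `u'` is negative whenever `u` equals a large
constant `K`, so `u` never crosses `K`. -/

theorem boltz_top (β : ℝ) : boltz β ⊤ = 0 := by simp [boltz]

theorem boltz_ofReal (β r : ℝ) :
    boltz β (ENNReal.ofReal r) = Real.exp (-(β * max r 0)) := by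
  simp [boltz, ENNReal.toReal_ofReal']

theorem boltz_nonneg (β : ℝ) (s : ℝ≥0∞) : 0 ≤ boltz β s := by
  unfold boltz; split_ifs <;> positivity

theorem boltz_le_one {β : ℝ} (hβ : 0 ≤ β) (s : ℝ≥0∞) : boltz β s ≤ 1 := by
  unfold boltz; split_ifs
  · exact zero_le_one
  · rw [Real.exp_le_one_iff]
    have : 0 ≤ β * s.toReal := by positivity
    linarith

theorem continuous_boltz (s : ℝ≥0∞) : Continuous fun β => boltz β s := by
  unfold boltz; split_ifs <;> fun_prop

/-- Summation by parts for a symmetric kernel. -/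
theorem neg_sum_mul_sum_sub_eq {E : Type*} [Fintype E] (k : E → E → ℝ)
    (hk : ∀ x y, k x y = k y x) (f : E → ℝ) :
    -∑ x, f x * ∑ y, (f y - f x) * k x y = (∑ x, ∑ y, k x y * (f x - f y) ^ 2) / 2 := by
  have h1 : ∑ x, f x * ∑ y, (f y - f x) * k x y
      = ∑ x, ∑ y, f x * ((f y - f x) * k x y) := by simp only [Finset.mul_sum]
  have h2 : ∑ x, ∑ y, f x * ((f y - f x) * k x y)
      = ∑ x, ∑ y, f y * ((f x - f y) * k x y) := by
    rw [Finset.sum_comm]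
    refine Finset.sum_congr rfl fun x _ => Finset.sum_congr rfl fun y _ => ?_
    rw [hk]
  have h3 : ∑ x, ∑ y, k x y * (f x - f y) ^ 2
      = -(∑ x, ∑ y, f x * ((f y - f x) * k x y) + ∑ x, ∑ y, f y * ((f x - f y) * k x y)) := by
    simp only [← Finset.sum_add_distrib, ← Finset.sum_neg_distrib]
    refine Finset.sum_congr rfl fun x _ => Finset.sum_congr rfl fun y _ => ?_
    ring
  rw [h3, ← h2, h1]; ring

/-- The variance as a sum over pairs. -/
theorem sum_sq_mul_sub_one_eq {E : Type*} [Fintype E] (w f : E → ℝ) (hw : ∑ x, w x = 1)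
    (hf : ∑ x, f x * w x = 1) :
    ∑ x, f x ^ 2 * w x - 1 = (∑ x, ∑ y, w x * w y * (f x - f y) ^ 2) / 2 := by
  have : ∑ x, ∑ y, w x * w y * (f x - f y) ^ 2
      = (∑ x, f x ^ 2 * w x) * ∑ y, w y + (∑ x, w x) * ∑ y, f y ^ 2 * w y
        - 2 * ((∑ x, f x * w x) * ∑ y, f y * w y) := by
    rw [Finset.sum_mul_sum, Finset.sum_mul_sum, Finset.sum_mul_sum, Finset.mul_sum]
    simp only [Finset.mul_sum, ← Finset.sum_add_distrib, ← Finset.sum_sub_distrib]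
    refine Finset.sum_congr rfl fun x _ => Finset.sum_congr rfl fun y _ => ?_
    ring
  rw [this, hw, hf]; ring

namespace Setting

variable {E Ω : Type*} [Fintype E] [DecidableEq E] [MeasurableSpace Ω] (𝒮 : Setting E Ω)

/-- The mean cost as a real number. -/
noncomputable def cost (x : E) : ℝ := (𝒮.J x).toReal

theorem J_le {x : E} (hx : x ∈ 𝒮.E') : 𝒮.J x ≤ ENNReal.ofReal 𝒮.M := by
  have := 𝒮.P_prob x
  calc 𝒮.J x ≤ ∫⁻ _, ENNReal.ofReal 𝒮.M ∂(𝒮.P x) := lintegral_mono fun ω => 𝒮.U_le x hx ω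
    _ = ENNReal.ofReal 𝒮.M := by simp

theorem J_ne_top {x : E} (hx : x ∈ 𝒮.E') : 𝒮.J x ≠ ⊤ :=
  ne_top_of_le_ne_top ENNReal.ofReal_ne_top (𝒮.J_le hx)

theorem J_eq_top {x : E} (hx : x ∉ 𝒮.E') : 𝒮.J x = ⊤ := by
  have := 𝒮.P_prob x
  simp [J, 𝒮.U_top x hx]

theorem mem_of_J_ne_top {x : E} (hx : 𝒮.J x ≠ ⊤) : x ∈ 𝒮.E' := by
  by_contra h
  exact hx (𝒮.J_eq_top h)

theorem cost_nonneg (x : E) : 0 ≤ 𝒮.cost x := ENNReal.toReal_nonneg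

theorem cost_le {x : E} (hx : x ∈ 𝒮.E') : 𝒮.cost x ≤ 𝒮.M :=
  ENNReal.toReal_le_of_le_ofReal 𝒮.M_pos.le (𝒮.J_le hx)

theorem ofReal_cost {x : E} (hx : x ∈ 𝒮.E') : ENNReal.ofReal (𝒮.cost x) = 𝒮.J x :=
  ENNReal.ofReal_toReal (𝒮.J_ne_top hx)

theorem boltz_J (β : ℝ) {x : E} (hx : x ∈ 𝒮.E') :
    boltz β (𝒮.J x) = Real.exp (-(β * 𝒮.cost x)) := by
  simp [boltz, 𝒮.J_ne_top hx, cost]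

theorem boltz_J_eq_zero (β : ℝ) {x : E} (hx : x ∉ 𝒮.E') : boltz β (𝒮.J x) = 0 := by
  rw [𝒮.J_eq_top hx, boltz_top]

theorem boltz_J_sub (β : ℝ) {x y : E} (hx : x ∈ 𝒮.E') (hy : y ∈ 𝒮.E') :
    boltz β (𝒮.J y - 𝒮.J x) = Real.exp (-(β * max (𝒮.cost y - 𝒮.cost x) 0)) := by
  rw [← 𝒮.ofReal_cost hx, ← 𝒮.ofReal_cost hy, ← ENNReal.ofReal_sub _ (𝒮.cost_nonneg x),
    boltz_ofReal]

theorem boltz_J_sub_eq_zero (β : ℝ) {x y : E} (hx : x ∈ 𝒮.E') (hy : y ∉ 𝒮.E') :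
    boltz β (𝒮.J y - 𝒮.J x) = 0 := by
  rw [𝒮.J_eq_top hy, ENNReal.top_sub (𝒮.J_ne_top hx), boltz_top]

theorem μ₀_le_one (x : E) : 𝒮.μ₀ x ≤ 1 := by
  rw [← 𝒮.μ₀_sum]
  exact Finset.single_le_sum (fun y _ => 𝒮.μ₀_nonneg y) (Finset.mem_univ x)

/-- The normalising constant of the Gibbs distribution. -/
noncomputable def partition (w : E → ℝ) (β : ℝ) : ℝ := ∑ z, w z * boltz β (𝒮.J z)

theorem partition_pos {w : E → ℝ} (hw : ∀ x, 0 ≤ w x) (hw' : ∀ x ∈ 𝒮.E', 0 < w x)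
    (hE : 𝒮.E'.Nonempty) (β : ℝ) : 0 < 𝒮.partition w β := by
  obtain ⟨x, hx⟩ := hE
  refine Finset.sum_pos' (fun z _ => mul_nonneg (hw z) (boltz_nonneg _ _)) ⟨x, Finset.mem_univ x, ?_⟩
  rw [𝒮.boltz_J β hx]
  exact mul_pos (hw' x hx) (Real.exp_pos _)

theorem gibbs_eq (w : E → ℝ) (β : ℝ) (x : E) :
    𝒮.gibbs w β x = w x * boltz β (𝒮.J x) / 𝒮.partition w β := rfl

theorem gibbs_eq_zero (w : E → ℝ) (β : ℝ) {x : E} (hx : x ∉ 𝒮.E') : 𝒮.gibbs w β x = 0 := by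
  simp [gibbs, 𝒮.boltz_J_eq_zero β hx]

theorem gibbs_nonneg {w : E → ℝ} (hw : ∀ x, 0 ≤ w x) (β : ℝ) (x : E) : 0 ≤ 𝒮.gibbs w β x :=
  div_nonneg (mul_nonneg (hw x) (boltz_nonneg _ _))
    (Finset.sum_nonneg fun z _ => mul_nonneg (hw z) (boltz_nonneg _ _))

theorem gibbs_pos {w : E → ℝ} (hw : ∀ x, 0 ≤ w x) (hw' : ∀ x ∈ 𝒮.E', 0 < w x)
    (β : ℝ) {x : E} (hx : x ∈ 𝒮.E') : 0 < 𝒮.gibbs w β x := by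
  refine div_pos (mul_pos (hw' x hx) ?_) (𝒮.partition_pos hw hw' ⟨x, hx⟩ β)
  rw [𝒮.boltz_J β hx]
  exact Real.exp_pos _

theorem sum_gibbs {w : E → ℝ} (hw : ∀ x, 0 ≤ w x) (hw' : ∀ x ∈ 𝒮.E', 0 < w x)
    (hE : 𝒮.E'.Nonempty) (β : ℝ) : ∑ x, 𝒮.gibbs w β x = 1 := by
  simp only [gibbs_eq, ← Finset.sum_div]
  exact div_self (𝒮.partition_pos hw hw' hE β).ne'

theorem q_nonneg (β : ℝ) {x y : E} (hxy : y ≠ x) : 0 ≤ 𝒮.q β x y := by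
  rw [q, if_neg hxy]
  exact mul_nonneg (𝒮.q₀_nonneg _ _) (boltz_nonneg _ _)

/-- The flow of the Gibbs distribution through an edge. -/
theorem gibbs_mul_q (β : ℝ) {x y : E} (hx : x ∈ 𝒮.E') (hy : y ∈ 𝒮.E') (hxy : y ≠ x) :
    𝒮.gibbs 𝒮.μ₀ β x * 𝒮.q β x y
      = 𝒮.μ₀ x * 𝒮.q₀ x y * Real.exp (-(β * max (𝒮.cost x) (𝒮.cost y)))
        / 𝒮.partition 𝒮.μ₀ β := by
  have h : Real.exp (-(β * max (𝒮.cost x) (𝒮.cost y)))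
      = Real.exp (-(β * 𝒮.cost x)) * Real.exp (-(β * max (𝒮.cost y - 𝒮.cost x) 0)) := by
    rw [← Real.exp_add]
    congr 1
    rcases le_total (𝒮.cost x) (𝒮.cost y) with h | h
    · rw [max_eq_right h, max_eq_left (by linarith)]; ring
    · rw [max_eq_left h, max_eq_right (by linarith)]; ring
  rw [q, if_neg hxy, gibbs_eq, 𝒮.boltz_J β hx, 𝒮.boltz_J_sub β hx hy, h]
  ring

theorem gibbs_mul_q_comm (β : ℝ) (x y : E) :
    𝒮.gibbs 𝒮.μ₀ β x * 𝒮.q β x y = 𝒮.gibbs 𝒮.μ₀ β y * 𝒮.q β y x := by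
  by_cases hxy : y = x
  · rw [hxy]
  by_cases hx : x ∈ 𝒮.E' <;> by_cases hy : y ∈ 𝒮.E'
  · rw [𝒮.gibbs_mul_q β hx hy hxy, 𝒮.gibbs_mul_q β hy hx (Ne.symm hxy), 𝒮.q₀_reversible x y,
      max_comm]
  · rw [𝒮.gibbs_eq_zero _ β hy, q, if_neg hxy, 𝒮.boltz_J_sub_eq_zero β hx hy]; ring
  · rw [𝒮.gibbs_eq_zero _ β hx, q, q, if_neg (Ne.symm hxy), 𝒮.boltz_J_sub_eq_zero β hy hx]; ring
  · rw [𝒮.gibbs_eq_zero _ β hx, 𝒮.gibbs_eq_zero _ β hy]; ring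

/-- The Dirichlet form of noise-free annealing. -/
noncomputable def energy (β : ℝ) (f : E → ℝ) : ℝ :=
  (∑ x, ∑ y, 𝒮.gibbs 𝒮.μ₀ β x * 𝒮.q β x y * (f x - f y) ^ 2) / 2

theorem neg_sum_mul_L_eq (β : ℝ) (f : E → ℝ) :
    -∑ x, f x * 𝒮.L β f x * 𝒮.gibbs 𝒮.μ₀ β x = 𝒮.energy β f := by
  rw [energy, ← neg_sum_mul_sum_sub_eq _ (𝒮.gibbs_mul_q_comm β)]
  congr 1
  refine Finset.sum_congr rfl fun x _ => ?_
  rw [L, mul_assoc, Finset.sum_mul]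
  congr 1
  exact Finset.sum_congr rfl fun y _ => by ring

theorem energy_term_nonneg (β : ℝ) (f : E → ℝ) (x y : E) :
    0 ≤ 𝒮.gibbs 𝒮.μ₀ β x * 𝒮.q β x y * (f x - f y) ^ 2 := by
  by_cases hxy : y = x
  · simp [hxy]
  · exact mul_nonneg (mul_nonneg (𝒮.gibbs_nonneg 𝒮.μ₀_nonneg β x) (𝒮.q_nonneg β hxy)) (sq_nonneg _)

theorem energy_nonneg (β : ℝ) (f : E → ℝ) : 0 ≤ 𝒮.energy β f :=
  div_nonneg (Finset.sum_nonneg fun x _ => Finset.sum_nonneg fun y _ =>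
    𝒮.energy_term_nonneg β f x y) zero_le_two

theorem energy_term_le (β : ℝ) (f : E → ℝ) (x y : E) :
    𝒮.gibbs 𝒮.μ₀ β x * 𝒮.q β x y * (f x - f y) ^ 2 ≤ 2 * 𝒮.energy β f := by
  rw [energy, mul_div_cancel₀ _ two_ne_zero]
  refine le_trans ?_ (Finset.single_le_sum
    (f := fun x => ∑ y, 𝒮.gibbs 𝒮.μ₀ β x * 𝒮.q β x y * (f x - f y) ^ 2)
    (fun x _ => Finset.sum_nonneg fun y _ => 𝒮.energy_term_nonneg β f x y) (Finset.mem_univ x))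
  exact Finset.single_le_sum (f := fun y => 𝒮.gibbs 𝒮.μ₀ β x * 𝒮.q β x y * (f x - f y) ^ 2)
    (fun y _ => 𝒮.energy_term_nonneg β f x y) (Finset.mem_univ y)

/-- The infimum over infinitely many paths is attained because `J` takes finitely many values: if
every path exceeded `a`, each would reach the least value of `J` above `a`, and so would the
elevation. -/
theorem exists_path_le (hm : 𝒮.mStar ≠ ⊤) {x y : E} (hx : x ∈ 𝒮.E') (hy : y ∈ 𝒮.E') :
    ∃ n p, 𝒮.IsPath x y n p ∧ ∀ i ≤ n, 𝒮.J (p i) ≤ 𝒮.mStar + max (𝒮.J x) (𝒮.J y) := by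
  set a := 𝒮.mStar + max (𝒮.J x) (𝒮.J y) with ha
  have hle : 𝒮.elevation x y ≤ a := by
    rw [ha, ← tsub_le_iff_right]
    exact le_iSup₂_of_le x hx (le_iSup₂_of_le y hy le_rfl)
  have ha_top : a < ⊤ := by
    rw [ha, ENNReal.add_lt_top]
    exact ⟨hm.lt_top, max_lt (𝒮.J_ne_top hx).lt_top (𝒮.J_ne_top hy).lt_top⟩
  by_contra! hcon
  have hlt : a < (Finset.univ.filter fun z => a < 𝒮.J z).inf 𝒮.J := by
    rw [Finset.lt_inf_iff ha_top]
    intro z hz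
    exact (Finset.mem_filter.mp hz).2
  refine absurd hle (not_le.mpr (hlt.trans_le ?_))
  refine le_iInf fun n => le_iInf fun p => le_iInf fun hp => ?_
  obtain ⟨i, hi, hlt'⟩ := hcon n p hp
  exact (Finset.inf_le (f := 𝒮.J) (Finset.mem_filter.mpr ⟨Finset.mem_univ (p i), hlt'⟩)).trans
    (le_iSup₂_of_le (f := fun (i : ℕ) (_ : i ≤ n) => 𝒮.J (p i)) i hi le_rfl)

/-- One factor is bounded by `1`; the one kept belongs to the point of larger cost. -/
theorem gibbs_mul_gibbs_le {β : ℝ} {x y : E} (hx : x ∈ 𝒮.E') (hy : y ∈ 𝒮.E') :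
    𝒮.gibbs 𝒮.μ₀ β x * 𝒮.gibbs 𝒮.μ₀ β y
      ≤ Real.exp (-(β * max (𝒮.cost x) (𝒮.cost y))) / 𝒮.partition 𝒮.μ₀ β := by
  have hZ := 𝒮.partition_pos 𝒮.μ₀_nonneg 𝒮.μ₀_pos ⟨x, hx⟩ β
  have h1 : ∀ z, 𝒮.gibbs 𝒮.μ₀ β z ≤ 1 := fun z => by
    rw [← 𝒮.sum_gibbs 𝒮.μ₀_nonneg 𝒮.μ₀_pos ⟨x, hx⟩ β]
    exact Finset.single_le_sum (fun y _ => 𝒮.gibbs_nonneg 𝒮.μ₀_nonneg β y) (Finset.mem_univ z)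
  have h2 : ∀ z ∈ 𝒮.E', 𝒮.gibbs 𝒮.μ₀ β z
      ≤ Real.exp (-(β * 𝒮.cost z)) / 𝒮.partition 𝒮.μ₀ β := fun z hz => by
    rw [gibbs_eq, 𝒮.boltz_J β hz]
    gcongr
    exact mul_le_of_le_one_left (Real.exp_pos _).le (𝒮.μ₀_le_one z)
  rcases le_total (𝒮.cost x) (𝒮.cost y) with h | h
  · rw [max_eq_right h]
    exact (mul_le_of_le_one_left (𝒮.gibbs_nonneg 𝒮.μ₀_nonneg β y) (h1 x)).trans (h2 y hy)
  · rw [max_eq_left h]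
    exact (mul_le_of_le_one_right (𝒮.gibbs_nonneg 𝒮.μ₀_nonneg β x) (h1 y)).trans (h2 x hx)

/-- The path method. Along a path of nearly minimal elevation, `f x - f y` telescopes into edge
increments, and each squared increment is paid for by the flow through its edge. The pair weight is
of order `e^{-β max(J x, J y)}` and the flow of order `e^{-β max}` over the edge, so their ratio is
at most a constant times `e^{m⋆ β}`. The path, hence `K`, does not depend on `β`. -/
theorem gibbs_mul_gibbs_mul_sq_le_energy (hm : 𝒮.mStar ≠ ⊤) (x y : E) :
    ∃ K : ℝ, 0 ≤ K ∧ ∀ β : ℝ, 0 ≤ β → ∀ f : E → ℝ,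
      𝒮.gibbs 𝒮.μ₀ β x * 𝒮.gibbs 𝒮.μ₀ β y * (f x - f y) ^ 2
        ≤ K * Real.exp (𝒮.mStar.toReal * β) * 𝒮.energy β f := by
  by_cases hx : x ∈ 𝒮.E'
  swap
  · exact ⟨0, le_rfl, fun β _ f => by simp [𝒮.gibbs_eq_zero _ β hx]⟩
  by_cases hy : y ∈ 𝒮.E'
  swap
  · exact ⟨0, le_rfl, fun β _ f => by simp [𝒮.gibbs_eq_zero _ β hy]⟩
  obtain ⟨n, p, ⟨hp0, hpn, hpS⟩, hle⟩ := 𝒮.exists_path_le hm hx hy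
  have hfin : 𝒮.mStar + max (𝒮.J x) (𝒮.J y) ≠ ⊤ :=
    ENNReal.add_ne_top.mpr ⟨hm, (max_lt (𝒮.J_ne_top hx).lt_top (𝒮.J_ne_top hy).lt_top).ne⟩
  have hpE : ∀ i ≤ n, p i ∈ 𝒮.E' := fun i hi =>
    𝒮.mem_of_J_ne_top (ne_top_of_le_ne_top hfin (hle i hi))
  have hcost : ∀ i ≤ n, 𝒮.cost (p i) ≤ 𝒮.mStar.toReal + max (𝒮.cost x) (𝒮.cost y) := fun i hi => by
    have := ENNReal.toReal_mono hfin (hle i hi)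
    rwa [ENNReal.toReal_add hm (max_lt (𝒮.J_ne_top hx).lt_top (𝒮.J_ne_top hy).lt_top).ne,
      ENNReal.toReal_max (𝒮.J_ne_top hx) (𝒮.J_ne_top hy)] at this
  have hκ : ∀ i ∈ Finset.range n, 0 < 𝒮.μ₀ (p i) * 𝒮.q₀ (p i) (p (i + 1)) := fun i hi =>
    mul_pos (𝒮.μ₀_pos _ (hpE i (Finset.mem_range.mp hi).le))
      (𝒮.q₀_pos _ _ (hpS i (Finset.mem_range.mp hi)))
  refine ⟨n * ∑ i ∈ Finset.range n, 2 * (𝒮.μ₀ (p i) * 𝒮.q₀ (p i) (p (i + 1)))⁻¹,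
    mul_nonneg n.cast_nonneg (Finset.sum_nonneg fun i hi =>
      mul_nonneg zero_le_two (inv_nonneg.mpr (hκ i hi).le)), fun β hβ f => ?_⟩
  have hZ := 𝒮.partition_pos 𝒮.μ₀_nonneg 𝒮.μ₀_pos ⟨x, hx⟩ β
  have hw : 0 ≤ 𝒮.gibbs 𝒮.μ₀ β x * 𝒮.gibbs 𝒮.μ₀ β y :=
    mul_nonneg (𝒮.gibbs_nonneg 𝒮.μ₀_nonneg β x) (𝒮.gibbs_nonneg 𝒮.μ₀_nonneg β y)
  have htel : (f x - f y) ^ 2 ≤ n * ∑ i ∈ Finset.range n, (f (p i) - f (p (i + 1))) ^ 2 := by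
    have := sq_sum_le_card_mul_sum_sq (s := Finset.range n)
      (f := fun i => f (p i) - f (p (i + 1)))
    rwa [Finset.sum_range_sub' (fun i => f (p i)), hp0, hpn, Finset.card_range] at this
  have hedge : ∀ i ∈ Finset.range n, 𝒮.gibbs 𝒮.μ₀ β x * 𝒮.gibbs 𝒮.μ₀ β y
      * (f (p i) - f (p (i + 1))) ^ 2 ≤ 2 * (𝒮.μ₀ (p i) * 𝒮.q₀ (p i) (p (i + 1)))⁻¹
        * (Real.exp (𝒮.mStar.toReal * β) * 𝒮.energy β f) := fun i hi => by
    have hi' := Finset.mem_range.mp hi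
    have hk := hκ i hi
    -- A path may use a loop, for which the flow formula fails but the increment is zero.
    by_cases hne : p (i + 1) = p i
    · rw [hne] at hk ⊢
      rw [sub_self, zero_pow two_ne_zero, mul_zero]
      have := 𝒮.energy_nonneg β f
      positivity
    have hflow := 𝒮.gibbs_mul_q β (hpE i hi'.le) (hpE (i + 1) hi') hne
    have hterm := 𝒮.energy_term_le β f (p i) (p (i + 1))
    rw [hflow] at hterm
    have hmax : max (𝒮.cost (p i)) (𝒮.cost (p (i + 1)))
        ≤ 𝒮.mStar.toReal + max (𝒮.cost x) (𝒮.cost y) := max_le (hcost i hi'.le) (hcost _ hi')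
    have hexp : Real.exp (-(β * max (𝒮.cost x) (𝒮.cost y)))
        ≤ Real.exp (𝒮.mStar.toReal * β)
          * Real.exp (-(β * max (𝒮.cost (p i)) (𝒮.cost (p (i + 1))))) := by
      rw [← Real.exp_add, Real.exp_le_exp]
      nlinarith [mul_le_mul_of_nonneg_left hmax hβ]
    set κ := 𝒮.μ₀ (p i) * 𝒮.q₀ (p i) (p (i + 1))
    calc _ ≤ Real.exp (𝒮.mStar.toReal * β)
          * Real.exp (-(β * max (𝒮.cost (p i)) (𝒮.cost (p (i + 1))))) / 𝒮.partition 𝒮.μ₀ β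
          * (f (p i) - f (p (i + 1))) ^ 2 := by
          refine mul_le_mul_of_nonneg_right ((𝒮.gibbs_mul_gibbs_le hx hy).trans ?_) (sq_nonneg _)
          gcongr
      _ = κ⁻¹ * Real.exp (𝒮.mStar.toReal * β) *
          (κ * Real.exp (-(β * max (𝒮.cost (p i)) (𝒮.cost (p (i + 1))))) / 𝒮.partition 𝒮.μ₀ β
          * (f (p i) - f (p (i + 1))) ^ 2) := by field_simp
      _ ≤ κ⁻¹ * Real.exp (𝒮.mStar.toReal * β) * (2 * 𝒮.energy β f) := by gcongr
      _ = _ := by ring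
  calc _ ≤ 𝒮.gibbs 𝒮.μ₀ β x * 𝒮.gibbs 𝒮.μ₀ β y
        * (n * ∑ i ∈ Finset.range n, (f (p i) - f (p (i + 1))) ^ 2) := by gcongr
    _ = n * ∑ i ∈ Finset.range n, 𝒮.gibbs 𝒮.μ₀ β x * 𝒮.gibbs 𝒮.μ₀ β y
        * (f (p i) - f (p (i + 1))) ^ 2 := by rw [← Finset.mul_sum]; ring
    _ ≤ n * ∑ i ∈ Finset.range n, 2 * (𝒮.μ₀ (p i) * 𝒮.q₀ (p i) (p (i + 1)))⁻¹
        * (Real.exp (𝒮.mStar.toReal * β) * 𝒮.energy β f) := by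
        exact mul_le_mul_of_nonneg_left (Finset.sum_le_sum hedge) n.cast_nonneg
    _ = _ := by rw [← Finset.sum_mul]; ring

/-- A Poincaré inequality with constant `c e^{-m β}`, written for densities. -/
def PoincareBound (c m : ℝ) : Prop :=
  ∀ β : ℝ, 0 ≤ β → ∀ f : E → ℝ, ∑ x, f x * 𝒮.gibbs 𝒮.μ₀ β x = 1 →
    c * Real.exp (-(m * β)) * (∑ x, f x ^ 2 * 𝒮.gibbs 𝒮.μ₀ β x - 1) ≤ 𝒮.energy β f

theorem exists_poincareBound (hE : 𝒮.E'.Nonempty) (hm : 𝒮.mStar ≠ ⊤) :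
    ∃ c : ℝ, 0 < c ∧ 𝒮.PoincareBound c 𝒮.mStar.toReal := by
  choose K hK0 hK using 𝒮.gibbs_mul_gibbs_mul_sq_le_energy hm
  have hS : 0 ≤ ∑ x, ∑ y, K x y := Finset.sum_nonneg fun x _ => Finset.sum_nonneg fun y _ => hK0 x y
  -- The summand `1` keeps the constant positive even if all the `K x y` vanish.
  refine ⟨(∑ x, ∑ y, K x y + 1)⁻¹, by positivity, fun β hβ f hf => ?_⟩
  rw [sum_sq_mul_sub_one_eq _ f (𝒮.sum_gibbs 𝒮.μ₀_nonneg 𝒮.μ₀_pos hE β) hf, Real.exp_neg]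
  have he := 𝒮.energy_nonneg β f
  have h1 : ∑ x, ∑ y, 𝒮.gibbs 𝒮.μ₀ β x * 𝒮.gibbs 𝒮.μ₀ β y * (f x - f y) ^ 2
      ≤ (∑ x, ∑ y, K x y) * (Real.exp (𝒮.mStar.toReal * β) * 𝒮.energy β f) := by
    simp only [Finset.sum_mul]
    refine Finset.sum_le_sum fun x _ => Finset.sum_le_sum fun y _ => ?_
    rw [← mul_assoc]
    exact hK x y β hβ f
  rw [← mul_inv, inv_mul_le_iff₀ (by positivity)]
  have h2 : 0 ≤ Real.exp (𝒮.mStar.toReal * β) * 𝒮.energy β f := by positivity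
  nlinarith [mul_nonneg hS h2]

theorem energy_normalize (β : ℝ) (f : E → ℝ) (s : ℝ) :
    𝒮.energy β (fun x => (f x - 1) / s) = 𝒮.energy β f / s ^ 2 := by
  simp only [energy, Finset.sum_div]
  refine Finset.sum_congr rfl fun x _ => Finset.sum_congr rfl fun y _ => ?_
  rw [← sub_div, sub_sub_sub_cancel_right, div_pow]
  ring

/-- The gap is tested on the centred and normalised density `(f - 1) / √(u - 1)`; when `u = 1` the
claim is just nonnegativity of the energy. -/
theorem poincareBound_of_le_gap (hE : 𝒮.E'.Nonempty) {c m : ℝ}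
    (h : ∀ β : ℝ, 0 ≤ β → c * Real.exp (-(m * β)) ≤ 𝒮.gap β) : 𝒮.PoincareBound c m := by
  intro β hβ f hf
  have hw := 𝒮.sum_gibbs 𝒮.μ₀_nonneg 𝒮.μ₀_pos hE β
  set u := ∑ x, f x ^ 2 * 𝒮.gibbs 𝒮.μ₀ β x with hu
  have hvar : ∑ x, (f x - 1) ^ 2 * 𝒮.gibbs 𝒮.μ₀ β x = u - 1 := by
    have : ∑ x, (f x - 1) ^ 2 * 𝒮.gibbs 𝒮.μ₀ β x
        = u - 2 * ∑ x, f x * 𝒮.gibbs 𝒮.μ₀ β x + ∑ x, 𝒮.gibbs 𝒮.μ₀ β x := by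
      simp only [hu, Finset.mul_sum, ← Finset.sum_sub_distrib, ← Finset.sum_add_distrib]
      exact Finset.sum_congr rfl fun x _ => by ring
    rw [this, hf, hw]; ring
  have hu1 : 0 ≤ u - 1 := by
    rw [← hvar]
    exact Finset.sum_nonneg fun x _ => mul_nonneg (sq_nonneg _) (𝒮.gibbs_nonneg 𝒮.μ₀_nonneg β x)
  rcases hu1.eq_or_lt with h0 | hpos
  · rw [← h0, mul_zero]; exact 𝒮.energy_nonneg β f
  have hs : (√(u - 1)) ^ 2 = u - 1 := Real.sq_sqrt hu1
  have hgap : 𝒮.gap β ≤ 𝒮.energy β f / (u - 1) := by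
    rw [← hs, ← energy_normalize, ← neg_sum_mul_L_eq]
    refine csInf_le ⟨0, ?_⟩ ⟨fun x => (f x - 1) / √(u - 1), ?_, ?_, rfl⟩
    · rintro r ⟨φ, -, -, rfl⟩
      rw [neg_sum_mul_L_eq]
      exact 𝒮.energy_nonneg β φ
    · simp only [div_pow, hs, div_mul_eq_mul_div, ← Finset.sum_div, hvar]
      exact div_self hpos.ne'
    · simp only [div_mul_eq_mul_div, ← Finset.sum_div, sub_mul, one_mul, Finset.sum_sub_distrib,
        hf, hw, sub_self, zero_div]
  rw [← le_div_iff₀ hpos]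
  exact (h β hβ).trans hgap

end Setting

end NoisyAnnealing
-- Concentration of mini-batches and the relative error of the acceptance probability.
namespace NoisyAnnealing

/-- The mean of a mini-batch. -/
noncomputable def batchMean {Ξ : Type*} (Y : Ξ → ℝ) (n : ℕ) (ω : Fin (n + 1) → Ξ) : ℝ :=
  (∑ i, Y (ω i)) / (n + 1)

theorem abs_batchMean_le {Ξ : Type*} {Y : Ξ → ℝ} {M : ℝ} (hM : ∀ ω, |Y ω| ≤ M) (n : ℕ) (ω : Fin (n + 1) → Ξ) :
    |batchMean Y n ω| ≤ M := by
  have hn : (0 : ℝ) < n + 1 := by positivity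
  rw [batchMean, abs_div, abs_of_pos hn, div_le_iff₀ hn]
  refine (Finset.abs_sum_le_sum_abs _ _).trans ((Finset.sum_le_sum fun i _ => hM (ω i)).trans ?_)
  simp [mul_comm]

section Concentration

variable {Ξ : Type*} [MeasurableSpace Ξ] {ν : Measure Ξ} [IsProbabilityMeasure ν]
  {Y : Ξ → ℝ} {M : ℝ}

theorem measurable_batchMean (hY : Measurable Y) (n : ℕ) : Measurable (batchMean Y n) := by
  unfold batchMean
  fun_prop

/-- Independence factors the integral into `n + 1` copies of a centred moment generating function at
`l / (n + 1)`, and Hoeffding's lemma on `[-M, M]` bounds each with variance proxy `M²`. -/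
theorem integral_exp_mul_batchMean_sub_le (hY : Measurable Y) (hM : ∀ ω, |Y ω| ≤ M) (n : ℕ)
    (l : ℝ) :
    ∫ ω, Real.exp (l * (batchMean Y n ω - ∫ ξ, Y ξ ∂ν)) ∂(Measure.pi fun _ => ν)
      ≤ Real.exp (l ^ 2 * M ^ 2 / (2 * (n + 1))) := by
  have hn : (0 : ℝ) < n + 1 := by positivity
  have h : ∀ ω, Real.exp (l * (batchMean Y n ω - ∫ ξ, Y ξ ∂ν))
      = ∏ i, Real.exp (l / (n + 1) * (Y (ω i) - ∫ ξ, Y ξ ∂ν)) := fun ω => by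
    rw [← Real.exp_sum, ← Finset.mul_sum, Finset.sum_sub_distrib, batchMean]
    congr 1
    simp only [Finset.sum_const, Finset.card_univ, Fintype.card_fin, nsmul_eq_mul]
    push_cast
    field_simp
  simp_rw [h]
  rw [integral_fintype_prod_eq_pow (fun ξ => Real.exp (l / (n + 1) * (Y ξ - ∫ ξ, Y ξ ∂ν)))]
  have hsub := (hasSubgaussianMGF_of_mem_Icc (μ := ν) (a := -M) (b := M) hY.aemeasurable
    (ae_of_all _ fun ω => abs_le.mp (hM ω))).mgf_le (l / (n + 1))
  have hc : (((‖M - -M‖₊ / 2) ^ 2 : ℝ≥0) : ℝ) = M ^ 2 := by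
    push_cast
    rw [Real.norm_eq_abs, div_pow, sq_abs]
    ring
  rw [hc, mgf] at hsub
  refine (pow_le_pow_left₀ (integral_nonneg fun _ => (Real.exp_pos _).le) hsub _).trans ?_
  rw [Fintype.card_fin, ← Real.exp_nat_mul]
  apply le_of_eq
  congr 1
  push_cast
  field_simp

theorem integrable_exp_mul_batchMean_sub (hY : Measurable Y) (hM : ∀ ω, |Y ω| ≤ M) (n : ℕ)
    (l c : ℝ) :
    Integrable (fun ω => Real.exp (l * (batchMean Y n ω - c))) (Measure.pi fun _ => ν) := by
  refine integrable_exp_mul_of_mem_Icc (a := -M - c) (b := M - c)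
    ((measurable_batchMean hY n).sub_const c).aemeasurable (ae_of_all _ fun ω => ?_)
  have := abs_le.mp (abs_batchMean_le hM n ω)
  constructor <;> linarith [this.1, this.2]

theorem exp_mul_abs_le (l z : ℝ) : Real.exp (l * |z|) ≤ Real.exp (l * z) + Real.exp (-l * z) := by
  rcases abs_cases z with ⟨h, -⟩ | ⟨h, -⟩ <;> rw [h]
  · linarith [Real.exp_pos (-l * z)]
  · rw [mul_neg, ← neg_mul]
    linarith [Real.exp_pos (l * z)]

theorem integrable_exp_mul_abs_batchMean_sub (hY : Measurable Y) (hM : ∀ ω, |Y ω| ≤ M) (n : ℕ)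
    (l c : ℝ) :
    Integrable (fun ω => Real.exp (l * |batchMean Y n ω - c|)) (Measure.pi fun _ => ν) := by
  refine ((integrable_exp_mul_batchMean_sub (ν := ν) hY hM n l c).add
    (integrable_exp_mul_batchMean_sub hY hM n (-l) c)).mono' ?_ (ae_of_all _ fun ω => ?_)
  · have := measurable_batchMean hY n
    exact Measurable.aestronglyMeasurable (by fun_prop)
  · rw [Real.norm_eq_abs, Real.abs_exp]
    exact exp_mul_abs_le _ _

theorem integral_exp_mul_abs_batchMean_sub_le (hY : Measurable Y) (hM : ∀ ω, |Y ω| ≤ M) (n : ℕ)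
    (l : ℝ) :
    ∫ ω, Real.exp (l * |batchMean Y n ω - ∫ ξ, Y ξ ∂ν|) ∂(Measure.pi fun _ => ν)
      ≤ 2 * Real.exp (l ^ 2 * M ^ 2 / (2 * (n + 1))) := by
  refine (integral_mono (integrable_exp_mul_abs_batchMean_sub hY hM n l _)
    ((integrable_exp_mul_batchMean_sub hY hM n l _).add
      (integrable_exp_mul_batchMean_sub hY hM n (-l) _)) fun ω => exp_mul_abs_le l _).trans ?_
  simp only [Pi.add_apply]
  rw [integral_add (integrable_exp_mul_batchMean_sub hY hM n l _)
    (integrable_exp_mul_batchMean_sub hY hM n (-l) _)]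
  have h1 := integral_exp_mul_batchMean_sub_le (ν := ν) hY hM n l
  have h2 := integral_exp_mul_batchMean_sub_le (ν := ν) hY hM n (-l)
  rw [neg_sq] at h2
  linarith

theorem abs_exp_sub_one_le_mul_exp (z : ℝ) : |Real.exp z - 1| ≤ |z| * Real.exp |z| := by
  rcases le_total 0 z with h | h
  · rw [abs_of_nonneg h, abs_of_nonneg (by linarith [Real.add_one_le_exp z])]
    have h1 := Real.add_one_le_exp (-z)
    have h2 : Real.exp z * Real.exp (-z) = 1 := by rw [← Real.exp_add]; simp
    nlinarith [Real.exp_pos z]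
  · rw [abs_of_nonpos h, abs_of_nonpos (by linarith [Real.exp_le_one_iff.mpr h])]
    have h1 := Real.add_one_le_exp z
    have h2 := Real.one_le_exp (neg_nonneg.mpr h)
    nlinarith

/-- The positive part is 1-Lipschitz, and factoring out `e^{-β c⁺}` leaves `|e^z - 1| ≤ |z| e^{|z|}`
with `|z| ≤ β |a - c|`. Keeping the factor makes the error relative. -/
theorem abs_exp_neg_mul_posPart_sub_le {β : ℝ} (hβ : 0 ≤ β) (a c : ℝ) :
    |Real.exp (-(β * max a 0)) - Real.exp (-(β * max c 0))|
      ≤ Real.exp (-(β * max c 0)) * (β * |a - c| * Real.exp (β * |a - c|)) := by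
  have h : Real.exp (-(β * max a 0)) - Real.exp (-(β * max c 0))
      = Real.exp (-(β * max c 0)) * (Real.exp (β * (max c 0 - max a 0)) - 1) := by
    rw [mul_sub, ← Real.exp_add]; ring_nf
  have hz : |β * (max c 0 - max a 0)| ≤ β * |a - c| := by
    rw [abs_mul, abs_of_nonneg hβ, abs_sub_comm a c]
    exact mul_le_mul_of_nonneg_left (abs_max_sub_max_le_abs c a 0) hβ
  rw [h, abs_mul, Real.abs_exp]
  refine mul_le_mul_of_nonneg_left ((abs_exp_sub_one_le_mul_exp _).trans ?_) (Real.exp_pos _).le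
  exact mul_le_mul hz (Real.exp_le_exp.mpr hz) (Real.exp_pos _).le (by positivity)

/-- The relative error made by replacing a difference of costs by a mini-batch mean. -/
noncomputable def relError (s : ℝ) : ℝ := 2 * s * Real.exp ((1 + s) ^ 2 / 2)

theorem relError_mono {s s' : ℝ} (hs : 0 ≤ s) (h : s ≤ s') : relError s ≤ relError s' := by
  have hs' := hs.trans h
  unfold relError
  gcongr

theorem abs_integral_exp_batchMean_sub_le (hY : Measurable Y) (hMpos : 0 < M)
    (hM : ∀ ω, |Y ω| ≤ M) (n : ℕ) {β : ℝ} (hβ : 0 ≤ β) :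
    |∫ ω, Real.exp (-(β * max (batchMean Y n ω) 0)) ∂(Measure.pi fun _ => ν)
        - Real.exp (-(β * max (∫ ξ, Y ξ ∂ν) 0))|
      ≤ Real.exp (-(β * max (∫ ξ, Y ξ ∂ν) 0)) * relError (β * M / √(n + 1)) := by
  set c := ∫ ξ, Y ξ ∂ν with hc
  set s := β * M / √(n + 1) with hs
  have hn : (0 : ℝ) < n + 1 := by positivity
  have hsq : 0 < √((n : ℝ) + 1) := Real.sqrt_pos.mpr hn
  have hs0 : 0 ≤ s := by positivity
  -- With `Z = √(n+1) D / M` the deviation `D` in natural units, `β D = s Z`; from `Z ≤ e^Z` follows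
  -- `s Z e^{s Z} ≤ s e^{(1+s) Z}`, and this `l` makes `(1 + s) Z = l D`. The variance term then
  -- reduces to `(1 + s)² / 2`.
  set l := (1 + s) * √(n + 1) / M with hl
  have hmeas := measurable_batchMean hY n
  have hint : Integrable (fun ω => Real.exp (-(β * max (batchMean Y n ω) 0)))
      (Measure.pi fun _ => ν) := by
    refine Integrable.of_bound (C := 1) (Measurable.aestronglyMeasurable (by fun_prop))
      (ae_of_all _ fun ω => ?_)
    rw [Real.norm_eq_abs, Real.abs_exp, Real.exp_le_one_iff]
    have : 0 ≤ β * max (batchMean Y n ω) 0 := by positivity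
    linarith
  have hsub : ∫ ω, Real.exp (-(β * max (batchMean Y n ω) 0)) ∂(Measure.pi fun _ => ν)
        - Real.exp (-(β * max c 0))
      = ∫ ω, (Real.exp (-(β * max (batchMean Y n ω) 0)) - Real.exp (-(β * max c 0)))
          ∂(Measure.pi fun _ => ν) := by
    rw [integral_sub hint (integrable_const _)]; simp
  have hpt : ∀ ω, |Real.exp (-(β * max (batchMean Y n ω) 0)) - Real.exp (-(β * max c 0))|
      ≤ Real.exp (-(β * max c 0)) * (s * Real.exp (l * |batchMean Y n ω - c|)) := fun ω => by
    refine (abs_exp_neg_mul_posPart_sub_le hβ _ c).trans ?_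
    refine mul_le_mul_of_nonneg_left ?_ (Real.exp_pos _).le
    set D := |batchMean Y n ω - c|
    set Z := D * √(n + 1) / M with hZ
    have h1 : β * D = s * Z := by rw [hs, hZ]; field_simp
    have h2 : l * D = Z + s * Z := by rw [hl, hZ]; ring
    rw [h1, h2, Real.exp_add, mul_assoc]
    refine mul_le_mul_of_nonneg_left (mul_le_mul_of_nonneg_right ?_ (Real.exp_pos _).le) hs0
    linarith [Real.add_one_le_exp Z]
  have hbound : Integrable
      (fun ω => Real.exp (-(β * max c 0)) * (s * Real.exp (l * |batchMean Y n ω - c|)))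
      (Measure.pi fun _ => ν) :=
    ((integrable_exp_mul_abs_batchMean_sub hY hM n l c).const_mul s).const_mul _
  rw [hsub]
  refine abs_integral_le_integral_abs.trans ((integral_mono
    ((hint.sub (integrable_const _)).abs) hbound hpt).trans ?_)
  rw [integral_const_mul, integral_const_mul]
  refine mul_le_mul_of_nonneg_left ?_ (Real.exp_pos _).le
  have h3 := integral_exp_mul_abs_batchMean_sub_le (ν := ν) hY hM n l
  have h4 : l ^ 2 * M ^ 2 / (2 * (n + 1)) = (1 + s) ^ 2 / 2 := by
    rw [hl, div_pow, mul_pow, Real.sq_sqrt hn.le]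
    field_simp
  rw [h4] at h3
  calc _ ≤ s * (2 * Real.exp ((1 + s) ^ 2 / 2)) := mul_le_mul_of_nonneg_left h3 hs0
    _ = _ := by rw [relError]; ring

end Concentration

theorem integrable_exp_neg_poissonMeasure (r : ℝ≥0) :
    Integrable (fun n : ℕ => Real.exp (-n)) (poissonMeasure r) :=
  Integrable.of_bound (C := 1) (by fun_prop) (ae_of_all _ fun n => by
    rw [Real.norm_eq_abs, Real.abs_exp, Real.exp_le_one_iff]; simp)

/-- The Laplace transform at `1` is `exp(-r (1 - 1/e))`, obtained by recognising the Poisson weights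
of parameter `r/e`; then `1/e ≤ 1/2`. -/
theorem integral_exp_neg_poissonMeasure_le (r : ℝ≥0) :
    ∫ n : ℕ, Real.exp (-n) ∂(poissonMeasure r) ≤ Real.exp (-(r / 2)) := by
  have h := hasSum_one_poissonMeasure (r * Real.toNNReal (Real.exp (-1)))
  have he : ((Real.toNNReal (Real.exp (-1)) : ℝ≥0) : ℝ) = Real.exp (-1) :=
    Real.coe_toNNReal _ (Real.exp_pos _).le
  have h2 := (h.mul_left (Real.exp (-r + r * Real.exp (-1)))).tsum_eq
  rw [integral_poissonMeasure]
  have h3 : ∀ n : ℕ, (Real.exp (-r) * (r : ℝ) ^ n / n.factorial) • Real.exp (-n)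
      = Real.exp (-r + r * Real.exp (-1)) * (Real.exp (-↑(r * Real.toNNReal (Real.exp (-1))))
        * (↑(r * Real.toNNReal (Real.exp (-1))) : ℝ) ^ n / n.factorial) := fun n => by
    push_cast
    rw [he, smul_eq_mul, mul_pow, ← Real.exp_nat_mul, Real.exp_add, Real.exp_neg (r * Real.exp (-1))]
    field_simp
  simp_rw [h3]
  rw [h2, mul_one, Real.exp_le_exp]
  have h4 : Real.exp (-1) ≤ 1 / 2 := by
    rw [Real.exp_neg, ← one_div]
    exact one_div_le_one_div_of_le two_pos (by linarith [Real.add_one_le_exp (1 : ℝ)])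
  nlinarith [mul_le_mul_of_nonneg_left h4 r.coe_nonneg]

theorem measurable_boltz (β : ℝ) : Measurable (boltz β) := by
  unfold boltz
  exact Measurable.ite (measurableSet_singleton _) measurable_const (by fun_prop)

namespace Setting

variable {E Ω : Type*} [Fintype E] [DecidableEq E] [MeasurableSpace Ω] (𝒮 : Setting E Ω)

theorem isProbabilityMeasure_Q (x y : E) : IsProbabilityMeasure (𝒮.Q x y) := by
  have := 𝒮.P_prob x
  refine ⟨?_⟩
  have h : (𝒮.Q x y).map Prod.fst Set.univ = 1 := by rw [𝒮.Q_fst]; exact measure_univ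
  rwa [Measure.map_apply measurable_fst MeasurableSet.univ] at h

/-- The truncated difference of the mini-batch means of the costs. -/
noncomputable def batchDiff (n : ℕ) (x y : E) (ω : Fin (n + 1) → Ω × Ω) : ℝ≥0∞ :=
  (∑ i, 𝒮.U y (ω i).2) / ((n + 1 : ℕ) : ℝ≥0∞) - (∑ i, 𝒮.U x (ω i).1) / ((n + 1 : ℕ) : ℝ≥0∞)

/-- The probability of accepting the candidate `y` from `x` with `n + 1` samples. -/
noncomputable def acceptBatch (β : ℝ) (n : ℕ) (x y : E) : ℝ :=
  ∫ ω, boltz β (𝒮.batchDiff n x y ω) ∂(Measure.pi fun _ => 𝒮.Q x y)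

theorem accept_eq (β : ℝ) (r : ℝ≥0) (x y : E) :
    𝒮.accept β r x y = ∫ n, 𝒮.acceptBatch β n x y ∂(poissonMeasure r) := rfl

theorem measurable_batchDiff (n : ℕ) (x y : E) : Measurable (𝒮.batchDiff n x y) := by
  have := 𝒮.U_meas
  unfold batchDiff
  fun_prop

theorem integrable_boltz_batchDiff {β : ℝ} (hβ : 0 ≤ β) (n : ℕ) (x y : E) :
    Integrable (fun ω => boltz β (𝒮.batchDiff n x y ω)) (Measure.pi fun _ => 𝒮.Q x y) := by
  have := 𝒮.isProbabilityMeasure_Q x y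
  refine Integrable.of_bound (C := 1)
    ((measurable_boltz β).comp (𝒮.measurable_batchDiff n x y)).aestronglyMeasurable
    (ae_of_all _ fun ω => ?_)
  rw [Real.norm_eq_abs, abs_of_nonneg (boltz_nonneg _ _)]
  exact boltz_le_one hβ _

theorem acceptBatch_nonneg (β : ℝ) (n : ℕ) (x y : E) : 0 ≤ 𝒮.acceptBatch β n x y :=
  integral_nonneg fun _ => boltz_nonneg _ _

theorem acceptBatch_le_one {β : ℝ} (hβ : 0 ≤ β) (n : ℕ) (x y : E) :
    𝒮.acceptBatch β n x y ≤ 1 := by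
  have := 𝒮.isProbabilityMeasure_Q x y
  refine (integral_mono (𝒮.integrable_boltz_batchDiff hβ n x y) (integrable_const 1)
    fun ω => boltz_le_one hβ _).trans ?_
  simp

theorem integrable_acceptBatch {β : ℝ} (hβ : 0 ≤ β) (r : ℝ≥0) (x y : E) :
    Integrable (fun n => 𝒮.acceptBatch β n x y) (poissonMeasure r) :=
  Integrable.of_bound (C := 1) (by fun_prop) (ae_of_all _ fun n => by
    rw [Real.norm_eq_abs, abs_of_nonneg (𝒮.acceptBatch_nonneg _ _ _ _)]
    exact 𝒮.acceptBatch_le_one hβ n x y)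

theorem accept_nonneg (β : ℝ) (r : ℝ≥0) (x y : E) : 0 ≤ 𝒮.accept β r x y :=
  integral_nonneg fun n => 𝒮.acceptBatch_nonneg β n x y

theorem accept_le_one {β : ℝ} (hβ : 0 ≤ β) (r : ℝ≥0) (x y : E) : 𝒮.accept β r x y ≤ 1 := by
  refine (integral_mono (𝒮.integrable_acceptBatch hβ r x y) (integrable_const 1)
    fun n => 𝒮.acceptBatch_le_one hβ n x y).trans ?_
  simp

/-- A batch contains at least one sample, so the candidate's mean is infinite while the current one
is finite. The process therefore never leaves `E'`. -/
theorem accept_eq_zero (β : ℝ) (r : ℝ≥0) {x y : E} (hx : x ∈ 𝒮.E') (hy : y ∉ 𝒮.E') :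
    𝒮.accept β r x y = 0 := by
  have h : ∀ n ω, boltz β (𝒮.batchDiff n x y ω) = 0 := fun n ω => by
    have h1 : (∑ i, 𝒮.U y (ω i).2) / ((n + 1 : ℕ) : ℝ≥0∞) = ⊤ := by
      rw [ENNReal.div_eq_top]
      refine Or.inr ⟨?_, ENNReal.natCast_ne_top _⟩
      simp [𝒮.U_top y hy]
    have h2 : (∑ i, 𝒮.U x (ω i).1) / ((n + 1 : ℕ) : ℝ≥0∞) ≠ ⊤ := by
      refine ENNReal.div_ne_top (ENNReal.sum_ne_top.mpr fun i _ => ?_) (by simp)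
      exact ne_top_of_le_ne_top ENNReal.ofReal_ne_top (𝒮.U_le x hx _)
    rw [batchDiff, h1, ENNReal.top_sub h2, boltz_top]
  simp [accept_eq, acceptBatch, h]

theorem continuousOn_acceptBatch (n : ℕ) (x y : E) :
    ContinuousOn (fun β => 𝒮.acceptBatch β n x y) (Set.Ici 0) := by
  have := 𝒮.isProbabilityMeasure_Q x y
  refine continuousOn_of_dominated (bound := fun _ => 1) (fun β hβ =>
    (𝒮.integrable_boltz_batchDiff hβ n x y).aestronglyMeasurable)
    (fun β hβ => ae_of_all _ fun ω => ?_) (integrable_const 1)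
    (ae_of_all _ fun ω => (continuous_boltz _).continuousOn)
  rw [Real.norm_eq_abs, abs_of_nonneg (boltz_nonneg _ _)]
  exact boltz_le_one hβ _

/-- Weierstrass test: the Poisson weights are dominated by `R^n / n!`, where `R` bounds the
intensity on the compact set. Continuity in time makes the forward equation differentiable. -/
theorem continuousOn_accept {K : Set ℝ} (hK : IsCompact K) {β : ℝ → ℝ} {r : ℝ → ℝ≥0}
    (hβ : ContinuousOn β K) (hβ0 : ∀ t ∈ K, 0 ≤ β t) (hr : ContinuousOn (fun t => (r t : ℝ)) K)
    (x y : E) : ContinuousOn (fun t => 𝒮.accept (β t) (r t) x y) K := by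
  obtain ⟨R, hR⟩ := hK.exists_bound_of_continuousOn hr
  have heq : ∀ t, 𝒮.accept (β t) (r t) x y
      = ∑' n : ℕ, (Real.exp (-(r t : ℝ)) * (r t : ℝ) ^ n / (n.factorial : ℝ))
        * 𝒮.acceptBatch (β t) n x y := fun t => by
    rw [accept_eq, integral_poissonMeasure]
    rfl
  suffices hmain : ContinuousOn (fun t => ∑' n : ℕ, (Real.exp (-(r t : ℝ)) * (r t : ℝ) ^ n
      / (n.factorial : ℝ)) * 𝒮.acceptBatch (β t) n x y) K from
    hmain.congr fun t _ => heq t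
  have hsum := Real.summable_pow_div_factorial R
  refine continuousOn_tsum (fun n => ?_) hsum (fun n t ht => ?_)
  · have h1 : ContinuousOn (fun t => 𝒮.acceptBatch (β t) n x y) K :=
      (𝒮.continuousOn_acceptBatch n x y).comp hβ hβ0
    exact ((hr.neg.rexp.mul (hr.pow n)).div_const (n.factorial : ℝ)).mul h1
  · have hrR : (r t : ℝ) ≤ R := (le_abs_self _).trans (hR t ht)
    have h1 : Real.exp (-(r t : ℝ)) ≤ 1 := Real.exp_le_one_iff.mpr (by simp)
    have h2 : 0 ≤ Real.exp (-(r t : ℝ)) * (r t : ℝ) ^ n / (n.factorial : ℝ) := by positivity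
    rw [Real.norm_eq_abs, abs_mul, abs_of_nonneg h2, abs_of_nonneg (𝒮.acceptBatch_nonneg _ _ _ _)]
    refine (mul_le_of_le_one_right h2 (𝒮.acceptBatch_le_one (hβ0 t ht) n x y)).trans ?_
    refine div_le_div_of_nonneg_right ?_ (Nat.cast_nonneg _)
    calc _ ≤ 1 * (r t : ℝ) ^ n := mul_le_mul_of_nonneg_right h1 (pow_nonneg (r t).coe_nonneg n)
      _ ≤ R ^ n := by rw [one_mul]; exact pow_le_pow_left₀ (r t).coe_nonneg hrR n

theorem integral_U_fst (x y : E) : ∫ ω, (𝒮.U x ω.1).toReal ∂(𝒮.Q x y) = 𝒮.cost x := by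
  by_cases hx : x ∈ 𝒮.E'
  · rw [cost, J, ← integral_toReal (𝒮.U_meas x).aemeasurable
      (ae_of_all _ fun ω => (𝒮.U_le x hx ω).trans_lt ENNReal.ofReal_lt_top), ← 𝒮.Q_fst x y,
      integral_map measurable_fst.aemeasurable
        (𝒮.U_meas x).ennreal_toReal.aestronglyMeasurable]
  · simp [cost, 𝒮.J_eq_top hx, 𝒮.U_top x hx]

theorem integral_U_snd (x y : E) : ∫ ω, (𝒮.U y ω.2).toReal ∂(𝒮.Q x y) = 𝒮.cost y := by
  by_cases hy : y ∈ 𝒮.E'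
  · rw [cost, J, ← integral_toReal (𝒮.U_meas y).aemeasurable
      (ae_of_all _ fun ω => (𝒮.U_le y hy ω).trans_lt ENNReal.ofReal_lt_top), ← 𝒮.Q_snd x y,
      integral_map measurable_snd.aemeasurable
        (𝒮.U_meas y).ennreal_toReal.aestronglyMeasurable]
  · simp [cost, 𝒮.J_eq_top hy, 𝒮.U_top y hy]

/-- The difference of the noisy costs. -/
noncomputable def noisyDiff (x y : E) (ω : Ω × Ω) : ℝ := (𝒮.U y ω.2).toReal - (𝒮.U x ω.1).toReal

theorem toReal_U_le {x : E} (hx : x ∈ 𝒮.E') (ω : Ω) : (𝒮.U x ω).toReal ≤ 𝒮.M :=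
  ENNReal.toReal_le_of_le_ofReal 𝒮.M_pos.le (𝒮.U_le x hx ω)

theorem abs_noisyDiff_le {x y : E} (hx : x ∈ 𝒮.E') (hy : y ∈ 𝒮.E') (ω : Ω × Ω) :
    |𝒮.noisyDiff x y ω| ≤ 𝒮.M := by
  have h1 := 𝒮.toReal_U_le hx ω.1
  have h2 := 𝒮.toReal_U_le hy ω.2
  have h3 : 0 ≤ (𝒮.U x ω.1).toReal := ENNReal.toReal_nonneg
  have h4 : 0 ≤ (𝒮.U y ω.2).toReal := ENNReal.toReal_nonneg
  rw [noisyDiff, abs_le]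
  constructor <;> linarith

theorem measurable_noisyDiff (x y : E) : Measurable (𝒮.noisyDiff x y) := by
  have := 𝒮.U_meas
  unfold noisyDiff
  fun_prop

theorem integral_noisyDiff {x y : E} (hx : x ∈ 𝒮.E') (hy : y ∈ 𝒮.E') :
    ∫ ω, 𝒮.noisyDiff x y ω ∂(𝒮.Q x y) = 𝒮.cost y - 𝒮.cost x := by
  have := 𝒮.isProbabilityMeasure_Q x y
  have hU := 𝒮.U_meas
  have hbd : ∀ z ∈ 𝒮.E', ∀ ω, ‖(𝒮.U z ω).toReal‖ ≤ 𝒮.M := fun z hz ω => by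
    rw [Real.norm_eq_abs, abs_of_nonneg ENNReal.toReal_nonneg]
    exact 𝒮.toReal_U_le hz ω
  simp only [noisyDiff]
  rw [integral_sub, 𝒮.integral_U_fst, 𝒮.integral_U_snd]
  · exact Integrable.of_bound (C := 𝒮.M) (Measurable.aestronglyMeasurable (by fun_prop))
      (ae_of_all _ fun ω => hbd y hy ω.2)
  · exact Integrable.of_bound (C := 𝒮.M) (Measurable.aestronglyMeasurable (by fun_prop))
      (ae_of_all _ fun ω => hbd x hx ω.1)

theorem batchDiff_eq {x y : E} (hx : x ∈ 𝒮.E') (hy : y ∈ 𝒮.E') (n : ℕ)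
    (ω : Fin (n + 1) → Ω × Ω) :
    𝒮.batchDiff n x y ω = ENNReal.ofReal (batchMean (𝒮.noisyDiff x y) n ω) := by
  have hU : ∀ z ∈ 𝒮.E', ∀ ω, 𝒮.U z ω = ENNReal.ofReal (𝒮.U z ω).toReal := fun z hz ω =>
    (ENNReal.ofReal_toReal (ne_top_of_le_ne_top ENNReal.ofReal_ne_top (𝒮.U_le z hz ω))).symm
  have hn : (0 : ℝ) < n + 1 := by positivity
  have hsum : ∀ z ∈ 𝒮.E', ∀ v : Fin (n + 1) → Ω,
      (∑ i, 𝒮.U z (v i)) / ((n + 1 : ℕ) : ℝ≥0∞)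
        = ENNReal.ofReal ((∑ i, (𝒮.U z (v i)).toReal) / (n + 1)) := fun z hz v => by
    rw [ENNReal.ofReal_div_of_pos hn, ENNReal.ofReal_sum_of_nonneg
      fun i _ => ENNReal.toReal_nonneg]
    congr 1
    · exact Finset.sum_congr rfl fun i _ => hU z hz _
    · rw [← Nat.cast_add_one, ENNReal.ofReal_natCast]
  rw [batchDiff, hsum y hy fun i => (ω i).2, hsum x hx fun i => (ω i).1, ← ENNReal.ofReal_sub _
    (div_nonneg (Finset.sum_nonneg fun i _ => ENNReal.toReal_nonneg) hn.le), ← sub_div,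
    ← Finset.sum_sub_distrib]
  rfl

theorem abs_acceptBatch_sub_le {β : ℝ} (hβ : 0 ≤ β) {x y : E} (hx : x ∈ 𝒮.E') (hy : y ∈ 𝒮.E')
    (n : ℕ) :
    |𝒮.acceptBatch β n x y - boltz β (𝒮.J y - 𝒮.J x)|
      ≤ boltz β (𝒮.J y - 𝒮.J x) * relError (β * 𝒮.M / √(n + 1)) := by
  have := 𝒮.isProbabilityMeasure_Q x y
  have h := abs_integral_exp_batchMean_sub_le (ν := 𝒮.Q x y) (𝒮.measurable_noisyDiff x y)
    𝒮.M_pos (𝒮.abs_noisyDiff_le hx hy) n hβ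
  simpa only [acceptBatch, 𝒮.batchDiff_eq hx hy, boltz_ofReal, 𝒮.boltz_J_sub β hx hy,
    𝒮.integral_noisyDiff hx hy] using h

/-- The relative error of the noisy acceptance probability. -/
noncomputable def acceptError (β : ℝ) (r : ℝ≥0) : ℝ :=
  relError (2 * (β * 𝒮.M) / √r) + Real.exp (β * 𝒮.M - r / 4)

/-- Batches with `n ≥ r/4` obey the Hoeffding estimate. Smaller ones are handled by the trivial
error bound `1`, turned into a relative one at the price `e^{βM}`; their rarity compensates, leaving
`e^{βM - r/4}`. -/
theorem abs_accept_sub_le {β : ℝ} (hβ : 0 ≤ β) {r : ℝ≥0} (hr : 0 < r) {x y : E} (hx : x ∈ 𝒮.E')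
    (hy : y ∈ 𝒮.E') :
    |𝒮.accept β r x y - boltz β (𝒮.J y - 𝒮.J x)|
      ≤ boltz β (𝒮.J y - 𝒮.J x) * 𝒮.acceptError β r := by
  set e := boltz β (𝒮.J y - 𝒮.J x) with he
  have he0 : 0 ≤ e := boltz_nonneg _ _
  have hM := 𝒮.M_pos
  have hr' : (0 : ℝ) < r := hr
  have heM : 1 ≤ e * Real.exp (β * 𝒮.M) := by
    rw [he, 𝒮.boltz_J_sub β hx hy, ← Real.exp_add]
    refine Real.one_le_exp ?_
    have : max (𝒮.cost y - 𝒮.cost x) 0 ≤ 𝒮.M :=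
      max_le (by linarith [𝒮.cost_le hy, 𝒮.cost_nonneg x]) hM.le
    nlinarith [mul_le_mul_of_nonneg_left this hβ]
  have hrel : 0 ≤ relError (2 * (β * 𝒮.M) / √r) := by unfold relError; positivity
  have hpt : ∀ n : ℕ, |𝒮.acceptBatch β n x y - e|
      ≤ e * (relError (2 * (β * 𝒮.M) / √r)
        + Real.exp (β * 𝒮.M + r / 4) * Real.exp (-n)) := fun n => by
    rcases le_total ((r : ℝ) / 4) n with h | h
    · refine (𝒮.abs_acceptBatch_sub_le hβ hx hy n).trans (mul_le_mul_of_nonneg_left ?_ he0)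
      refine (relError_mono (by positivity) ?_).trans (le_add_of_nonneg_right (by positivity))
      have hsqrt : √(r : ℝ) ≤ 2 * √(n + 1) := by
        rw [Real.sqrt_le_left (by positivity), mul_pow, Real.sq_sqrt (by positivity)]
        linarith
      rw [div_le_div_iff₀ (by positivity) (by positivity)]
      nlinarith [mul_le_mul_of_nonneg_left hsqrt (mul_nonneg hβ hM.le)]
    · have h1 : |𝒮.acceptBatch β n x y - e| ≤ 1 := by
        rw [abs_le]
        have := 𝒮.acceptBatch_nonneg β n x y
        have := 𝒮.acceptBatch_le_one hβ n x y
        have := boltz_le_one hβ (𝒮.J y - 𝒮.J x)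
        constructor <;> linarith
      -- Chernoff: `1 ≤ e^{r/4 - n}` on this range, and integrating `e^{-n}` will give at most
      -- `e^{-r/2}`.
      have h2 : Real.exp (β * 𝒮.M) ≤ Real.exp (β * 𝒮.M + r / 4) * Real.exp (-n) := by
        rw [← Real.exp_add, Real.exp_le_exp]; linarith
      calc _ ≤ e * Real.exp (β * 𝒮.M) := h1.trans heM
        _ ≤ _ := mul_le_mul_of_nonneg_left (h2.trans (le_add_of_nonneg_left hrel)) he0
  have hint := 𝒮.integrable_acceptBatch hβ r x y
  have hsub : 𝒮.accept β r x y - e = ∫ n, (𝒮.acceptBatch β n x y - e) ∂(poissonMeasure r) := by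
    rw [integral_sub hint (integrable_const _), accept_eq]; simp
  have hexp := integrable_exp_neg_poissonMeasure r
  rw [hsub]
  refine abs_integral_le_integral_abs.trans ((integral_mono (hint.sub (integrable_const _)).abs
    (((integrable_const _).add (hexp.const_mul _)).const_mul _) hpt).trans ?_)
  simp only [Pi.add_apply]
  rw [integral_const_mul, integral_add (integrable_const _) (hexp.const_mul _), integral_const_mul,
    acceptError]
  refine mul_le_mul_of_nonneg_left ?_ he0
  simp only [integral_const, probReal_univ, one_smul]
  refine add_le_add_right ?_ _
  calc _ ≤ Real.exp (β * 𝒮.M + r / 4) * Real.exp (-(r / 2)) :=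
        mul_le_mul_of_nonneg_left (integral_exp_neg_poissonMeasure_le r) (Real.exp_pos _).le
    _ = _ := by rw [← Real.exp_add]; ring_nf

end Setting

end NoisyAnnealing
-- The jump chain: law at a fixed time, non-explosion and forward equation.
namespace NoisyAnnealing

open Filter Topology

/-- The probability that an exponential clock started at time `s` has not rung at time `t`,
with value `0` before the start. -/
noncomputable def survival (t s : ℝ) : ℝ≥0∞ :=
  if s ≤ t then ENNReal.ofReal (Real.exp (-(t - s))) else 0

theorem measurable_survival : Measurable fun z : ℝ × ℝ => survival z.1 z.2 := by
  unfold survival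
  exact Measurable.ite (measurableSet_le measurable_snd measurable_fst) (by fun_prop)
    measurable_const

theorem lintegral_exp_neg_Ici (c s : ℝ) :
    ∫⁻ t in Set.Ici c, ENNReal.ofReal (Real.exp (-(t - s)))
      = ENNReal.ofReal (Real.exp (-(c - s))) := by
  have h : ∀ t, Real.exp (-(t - s)) = Real.exp s * Real.exp (-t) := fun t => by
    rw [← Real.exp_add]; ring_nf
  simp_rw [h]
  rw [setLIntegral_congr Ioi_ae_eq_Ici.symm, ← ofReal_integral_eq_lintegral_ofReal
    ((integrableOn_exp_neg_Ioi c).const_mul _) (ae_of_all _ fun t => by positivity),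
    integral_const_mul, integral_exp_neg_Ioi]

theorem lintegral_survival_Ici (u s : ℝ) :
    ∫⁻ t in Set.Ici u, survival t s = ENNReal.ofReal (Real.exp (-(max u s - s))) := by
  have h : (fun t => survival t s)
      = (Set.Ici s).indicator fun t => ENNReal.ofReal (Real.exp (-(t - s))) := by
    funext t; simp [survival, Set.indicator_apply]
  rw [h, setLIntegral_indicator measurableSet_Ici, Set.Ici_inter_Ici, sup_comm,
    lintegral_exp_neg_Ici]

/-- `(χ_k, T_k)` is the Markov chain of the states and jump times of a process which jumps at
rate one, according to the transition matrix `p τ` at time `τ`. -/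
structure IsJumpChain {E : Type*} [Fintype E] (p : ℝ → E → E → ℝ) {Ω' : Type*}
    [MeasurableSpace Ω'] (Pr : Measure Ω') (χ : ℕ → Ω' → E) (T : ℕ → Ω' → ℝ) : Prop where
  continuous_kernel : ∀ x y, Continuous fun τ => p τ x y
  kernel_nonneg : ∀ τ x y, 0 ≤ p τ x y
  kernel_sum : ∀ τ x, ∑ y, p τ x y = 1
  measurable_state : ∀ k y, MeasurableSet {ω | χ k ω = y}
  measurable_time : ∀ k, Measurable (T k)
  start_time : ∀ᵐ ω ∂Pr, T 0 ω = 0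
  markov : ∀ (k : ℕ) (A : Set Ω'), MeasurableSet[past χ T k] A → ∀ (y : E) (u : ℝ), 0 ≤ u →
    Pr (A ∩ {ω | χ (k + 1) ω = y ∧ u ≤ T (k + 1) ω}) =
      ∫⁻ ω in A, (∫⁻ τ in Set.Ici u ∩ Set.Ici (T k ω),
        ENNReal.ofReal (p τ (χ k ω) y * Real.exp (-(τ - T k ω)))) ∂Pr

namespace IsJumpChain

theorem measurableSet_past_state {E Ω' : Type*} (χ : ℕ → Ω' → E) (T : ℕ → Ω' → ℝ) (k : ℕ) (x : E) :
    MeasurableSet[past χ T k] {ω | χ k ω = x} := by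
  have h : MeasurableSpace.comap (χ k) ⊤ ≤ past χ T k :=
    le_sup_left.trans (le_iSup₂_of_le (f := fun (j : ℕ) (_ : j ≤ k) =>
      MeasurableSpace.comap (χ j) ⊤ ⊔ MeasurableSpace.comap (T j) inferInstance) k le_rfl le_rfl)
  exact h _ ⟨{x}, trivial, rfl⟩

theorem measurableSet_past_time {E Ω' : Type*} (χ : ℕ → Ω' → E) (T : ℕ → Ω' → ℝ) (k : ℕ) {B : Set ℝ}
    (hB : MeasurableSet B) : MeasurableSet[past χ T k] (T k ⁻¹' B) := by
  have h : MeasurableSpace.comap (T k) inferInstance ≤ past χ T k :=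
    le_sup_right.trans (le_iSup₂_of_le (f := fun (j : ℕ) (_ : j ≤ k) =>
      MeasurableSpace.comap (χ j) ⊤ ⊔ MeasurableSpace.comap (T j) inferInstance) k le_rfl le_rfl)
  exact h _ ⟨B, hB, rfl⟩

variable {E : Type*} [Fintype E] {p : ℝ → E → E → ℝ} {Ω' : Type*} [MeasurableSpace Ω']
  {Pr : Measure Ω'} {χ : ℕ → Ω' → E} {T : ℕ → Ω' → ℝ}

variable (h : IsJumpChain p Pr χ T)
include h

theorem past_le (k : ℕ) : past χ T k ≤ ‹MeasurableSpace Ω'› := by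
  refine iSup₂_le fun j _ => sup_le ?_ (h.measurable_time j).comap_le
  rintro _ ⟨s, -, rfl⟩
  have : χ j ⁻¹' s = ⋃ x ∈ s, {ω | χ j ω = x} := by ext; simp
  rw [this]
  exact MeasurableSet.biUnion s.to_countable fun x _ => h.measurable_state j x

theorem measurable_rate (k : ℕ) (y : E) :
    Measurable fun z : Ω' × ℝ => ENNReal.ofReal (p z.2 (χ k z.1) y) * survival z.2 (T k z.1) := by
  let _ : MeasurableSpace E := ⊤
  have hχ : Measurable (χ k) := measurable_to_countable' fun x => h.measurable_state k x
  have hp : Measurable fun z : ℝ × E => p z.1 z.2 y :=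
    measurable_from_prod_countable_left fun x => (h.continuous_kernel x y).measurable
  have h1 : Measurable fun z : Ω' × ℝ => p z.2 (χ k z.1) y :=
    hp.comp (measurable_snd.prodMk (hχ.comp measurable_fst))
  exact h1.ennreal_ofReal.mul
    (measurable_survival.comp (measurable_snd.prodMk ((h.measurable_time k).comp measurable_fst)))

theorem measurable_rate_time (k : ℕ) (y : E) (ω : Ω') :
    Measurable fun τ => ENNReal.ofReal (p τ (χ k ω) y) * survival τ (T k ω) :=
  (h.measurable_rate k y).comp measurable_prodMk_left

theorem measurable_rate_sample (k : ℕ) (y : E) (τ : ℝ) :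
    Measurable fun ω => ENNReal.ofReal (p τ (χ k ω) y) * survival τ (T k ω) :=
  (h.measurable_rate k y).comp measurable_prodMk_right

theorem markov_rate {k : ℕ} {A : Set Ω'} (hA : MeasurableSet[past χ T k] A) (y : E) {u : ℝ}
    (hu : 0 ≤ u) : Pr (A ∩ {ω | χ (k + 1) ω = y ∧ u ≤ T (k + 1) ω}) =
      ∫⁻ ω in A, (∫⁻ τ in Set.Ici u,
        ENNReal.ofReal (p τ (χ k ω) y) * survival τ (T k ω)) ∂Pr := by
  rw [h.markov k A hA y u hu]
  refine lintegral_congr fun ω => ?_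
  rw [Set.inter_comm, ← setLIntegral_indicator measurableSet_Ici]
  refine lintegral_congr fun τ => ?_
  by_cases hτ : T k ω ≤ τ
  · simp [survival, hτ, ENNReal.ofReal_mul (h.kernel_nonneg _ _ _)]
  · simp [survival, hτ]

theorem sum_ofReal_kernel (τ : ℝ) (x : E) : ∑ y, ENNReal.ofReal (p τ x y) = 1 := by
  rw [← ENNReal.ofReal_sum_of_nonneg fun y _ => h.kernel_nonneg τ x y, h.kernel_sum,
    ENNReal.ofReal_one]

theorem measure_eq_sum_state (k : ℕ) {A : Set Ω'} (hA : MeasurableSet A) :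
    Pr A = ∑ y, Pr (A ∩ {ω | χ k ω = y}) := by
  rw [← measure_biUnion_finset]
  · congr 1; ext ω; simp
  · intro y _ z _ hyz
    refine Set.disjoint_left.mpr fun ω h1 h2 => hyz ?_
    exact h1.2.symm.trans h2.2
  · exact fun y _ => hA.inter (h.measurable_state k y)

/-- Summing the Markov property over the next state removes the kernel, whose rows sum to one, and
leaves a pure exponential waiting time. -/
theorem measure_inter_le_time {k : ℕ} {A : Set Ω'} (hA : MeasurableSet[past χ T k] A) {u : ℝ}
    (hu : 0 ≤ u) : Pr (A ∩ {ω | u ≤ T (k + 1) ω}) =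
      ∫⁻ ω in A, ENNReal.ofReal (Real.exp (-(max u (T k ω) - T k ω))) ∂Pr := by
  have hA' := h.past_le k _ hA
  rw [h.measure_eq_sum_state (k + 1)
    (hA'.inter (measurableSet_le measurable_const (h.measurable_time (k + 1))))]
  have : ∀ y, Pr (A ∩ {ω | u ≤ T (k + 1) ω} ∩ {ω | χ (k + 1) ω = y})
      = ∫⁻ ω in A, (∫⁻ τ in Set.Ici u,
        ENNReal.ofReal (p τ (χ k ω) y) * survival τ (T k ω)) ∂Pr := fun y => by
    rw [← h.markov_rate hA y hu]
    congr 1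
    ext ω
    simp only [Set.mem_inter_iff, Set.mem_ofPred_eq]
    tauto
  simp_rw [this]
  rw [← lintegral_finsetSum _ fun y _ => (h.measurable_rate k y).lintegral_prod_right']
  refine lintegral_congr fun ω => ?_
  rw [← lintegral_finsetSum _ fun y _ => h.measurable_rate_time k y ω]
  simp_rw [← Finset.sum_mul, h.sum_ofReal_kernel, one_mul]
  exact lintegral_survival_Ici _ _

theorem time_nonneg [IsProbabilityMeasure Pr] (k : ℕ) : ∀ᵐ ω ∂Pr, 0 ≤ T k ω := by
  induction k with
  | zero => filter_upwards [h.start_time] with ω hω using hω.ge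
  | succ k ih =>
    have h1 := h.measure_inter_le_time (k := k) (A := Set.univ) MeasurableSet.univ le_rfl
    have h2 : ∫⁻ ω in Set.univ, ENNReal.ofReal (Real.exp (-(max 0 (T k ω) - T k ω))) ∂Pr = 1 := by
      rw [Measure.restrict_univ, lintegral_congr_ae (g := fun _ => 1), lintegral_one, measure_univ]
      filter_upwards [ih] with ω hω
      simp [hω]
    rw [h2, Set.univ_inter] at h1
    exact (mem_ae_iff_prob_eq_one
      (measurableSet_le measurable_const (h.measurable_time (k + 1)))).mpr h1

/-- If `T_{k+1} < T_k`, some rational lies between them. For each fixed `u ≥ 0`, the event `u ≤ T_k`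
loses no mass when `u ≤ T_{k+1}` is added, since the waiting factor is then `1`. Nonnegative
rationals suffice because the times are nonnegative. -/
theorem time_mono [IsProbabilityMeasure Pr] (k : ℕ) : ∀ᵐ ω ∂Pr, T k ω ≤ T (k + 1) ω := by
  have hrat : ∀ u : ℚ, 0 ≤ u → ∀ᵐ ω ∂Pr, (u : ℝ) ≤ T k ω → (u : ℝ) ≤ T (k + 1) ω := fun u hu => by
    have hu' : (0 : ℝ) ≤ u := by exact_mod_cast hu
    have hA : MeasurableSet[past χ T k] {ω | (u : ℝ) ≤ T k ω} :=
      measurableSet_past_time χ T k measurableSet_Ici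
    have hA' := h.past_le k _ hA
    have h1 := h.measure_inter_le_time hA hu'
    have h2 : ∫⁻ ω in {ω | (u : ℝ) ≤ T k ω},
        ENNReal.ofReal (Real.exp (-(max (u : ℝ) (T k ω) - T k ω))) ∂Pr
        = Pr {ω | (u : ℝ) ≤ T k ω} := by
      rw [setLIntegral_congr_fun (g := fun _ => 1) hA' fun ω hω => ?_, setLIntegral_one]
      simp [max_eq_right (show (u : ℝ) ≤ T k ω from hω)]
    rw [h2] at h1
    have hB := measurableSet_le (measurable_const (a := (u : ℝ))) (h.measurable_time (k + 1))
    have h3 : Pr ({ω | (u : ℝ) ≤ T k ω} \ {ω | (u : ℝ) ≤ T (k + 1) ω}) = 0 := by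
      have := measure_inter_add_sdiff (μ := Pr) {ω | (u : ℝ) ≤ T k ω} hB
      rw [h1] at this
      exact (ENNReal.add_right_inj (measure_ne_top _ _)).mp (this.trans (add_zero _).symm)
    filter_upwards [measure_eq_zero_iff_ae_notMem.mp h3] with ω hω h4
    by_contra h5
    exact hω ⟨h4, h5⟩
  have hrat' : ∀ᵐ ω ∂Pr, ∀ u : ℚ, 0 ≤ u → (u : ℝ) ≤ T k ω → (u : ℝ) ≤ T (k + 1) ω := by
    refine ae_all_iff.mpr fun u => ?_
    by_cases hu : 0 ≤ u
    · filter_upwards [hrat u hu] with ω hω _ using hω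
    · exact ae_of_all _ fun ω h1 => absurd h1 hu
  filter_upwards [hrat', h.time_nonneg (k + 1)] with ω h1 h2
  by_contra! hlt
  obtain ⟨u, hu1, hu2⟩ := exists_rat_btwn hlt
  have hu0 : (0 : ℚ) ≤ u := by exact_mod_cast h2.trans hu1.le
  exact absurd (h1 u hu0 hu2.le) (not_le.mpr hu1)

/-- The joint law of a state and a jump time, given an event of the past. -/
theorem measure_inter_state_time [IsProbabilityMeasure Pr] {k : ℕ} {A : Set Ω'}
    (hA : MeasurableSet[past χ T k] A) (y : E) {B : Set ℝ} (hB : MeasurableSet B) :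
    Pr (A ∩ {ω | χ (k + 1) ω = y} ∩ T (k + 1) ⁻¹' B) =
      ∫⁻ τ in B ∩ Set.Ici 0,
        (∫⁻ ω in A, ENNReal.ofReal (p τ (χ k ω) y) * survival τ (T k ω) ∂Pr) := by
  have hA' := h.past_le k _ hA
  have hC : MeasurableSet (A ∩ {ω | χ (k + 1) ω = y}) := hA'.inter (h.measurable_state _ _)
  have hT := h.measurable_time (k + 1)
  have hmeas : Measurable fun τ =>
      ∫⁻ ω in A, ENNReal.ofReal (p τ (χ k ω) y) * survival τ (T k ω) ∂Pr :=
    (h.measurable_rate k y).lintegral_prod_left'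
  -- Two finite measures on the line agree once they agree on all half-lines `[u, ∞)`. The Markov
  -- property gives this for `u ≥ 0`; below zero neither side has mass.
  have key : (Pr.restrict (A ∩ {ω | χ (k + 1) ω = y})).map (T (k + 1))
      = (volume.restrict (Set.Ici 0)).withDensity fun τ =>
        ∫⁻ ω in A, ENNReal.ofReal (p τ (χ k ω) y) * survival τ (T k ω) ∂Pr := by
    have : IsFiniteMeasure ((Pr.restrict (A ∩ {ω | χ (k + 1) ω = y})).map (T (k + 1))) :=
      inferInstance
    have hpos : ∀ u : ℝ, 0 ≤ u →
        (Pr.restrict (A ∩ {ω | χ (k + 1) ω = y})).map (T (k + 1)) (Set.Ici u)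
        = ((volume.restrict (Set.Ici 0)).withDensity fun τ =>
          ∫⁻ ω in A, ENNReal.ofReal (p τ (χ k ω) y) * survival τ (T k ω) ∂Pr) (Set.Ici u) := by
      intro u hu
      rw [Measure.map_apply hT measurableSet_Ici, Measure.restrict_apply (hT measurableSet_Ici),
        withDensity_apply _ measurableSet_Ici, Measure.restrict_restrict measurableSet_Ici,
        Set.inter_eq_left.mpr (Set.Ici_subset_Ici.mpr hu),
        lintegral_lintegral_swap (μ := volume.restrict (Set.Ici u))
          (f := fun τ ω => ENNReal.ofReal (p τ (χ k ω) y) * survival τ (T k ω))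
          ((h.measurable_rate k y).comp measurable_swap).aemeasurable,
        ← h.markov_rate hA y hu]
      congr 1
      ext ω
      simp only [Set.mem_inter_iff, Set.mem_preimage, Set.mem_Ici, Set.mem_ofPred_eq]
      tauto
    refine Measure.ext_of_Ici _ _ fun u => ?_
    rcases le_total 0 u with hu | hu
    · exact hpos u hu
    · have h1 : (Pr.restrict (A ∩ {ω | χ (k + 1) ω = y})).map (T (k + 1)) (Set.Ici u)
          = (Pr.restrict (A ∩ {ω | χ (k + 1) ω = y})).map (T (k + 1)) (Set.Ici 0) := by
        rw [Measure.map_apply hT measurableSet_Ici, Measure.map_apply hT measurableSet_Ici]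
        refine measure_congr ?_
        filter_upwards [ae_restrict_of_ae (h.time_nonneg (k + 1))] with ω hω
        exact propext ⟨fun _ => hω, fun _ => hu.trans hω⟩
      rw [h1, hpos 0 le_rfl, withDensity_apply _ measurableSet_Ici,
        withDensity_apply _ measurableSet_Ici, Measure.restrict_restrict measurableSet_Ici,
        Measure.restrict_restrict measurableSet_Ici, Set.inter_self,
        Set.inter_eq_right.mpr (Set.Ici_subset_Ici.mpr hu)]
  have := congrArg (fun m => m B) key
  rwa [Measure.map_apply hT hB, Measure.restrict_apply (hT hB), withDensity_apply _ hB,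
    Measure.restrict_restrict hB, Set.inter_comm] at this

theorem measure_inter_time [IsProbabilityMeasure Pr] {k : ℕ} {A : Set Ω'}
    (hA : MeasurableSet[past χ T k] A) {B : Set ℝ} (hB : MeasurableSet B) :
    Pr (A ∩ T (k + 1) ⁻¹' B) =
      ∫⁻ τ in B ∩ Set.Ici 0, (∫⁻ ω in A, survival τ (T k ω) ∂Pr) := by
  have hA' := h.past_le k _ hA
  rw [h.measure_eq_sum_state (k + 1) (hA'.inter (h.measurable_time (k + 1) hB))]
  simp_rw [Set.inter_right_comm A _ {ω | χ (k + 1) ω = _}]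
  simp_rw [h.measure_inter_state_time hA _ hB]
  rw [← lintegral_finsetSum _ fun y _ => (h.measurable_rate k y).lintegral_prod_left']
  refine lintegral_congr fun τ => ?_
  rw [← lintegral_finsetSum _ fun y _ => h.measurable_rate_sample k y τ]
  simp_rw [← Finset.sum_mul, h.sum_ofReal_kernel, one_mul]

theorem measure_time_eq [IsProbabilityMeasure Pr] (k : ℕ) (t : ℝ) :
    Pr {ω | T (k + 1) ω = t} = 0 := by
  have := h.measure_inter_time (k := k) (A := Set.univ) MeasurableSet.univ
    (measurableSet_singleton t)
  rw [Set.univ_inter, Measure.restrict_eq_zero.mpr, lintegral_zero_measure] at this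
  · exact this
  · exact measure_mono_null Set.inter_subset_left (by simp)

omit h in
/-- The probability of being in the state `x` at time `t`, after `k` jumps. -/
noncomputable def occupation (Pr : Measure Ω') (χ : ℕ → Ω' → E) (T : ℕ → Ω' → ℝ) (k : ℕ) (x : E)
    (t : ℝ) : ℝ≥0∞ := ∫⁻ ω in {ω | χ k ω = x}, survival t (T k ω) ∂Pr

theorem measurable_occupation [IsProbabilityMeasure Pr] (k : ℕ) (x : E) :
    Measurable (occupation Pr χ T k x) :=
  Measurable.lintegral_prod_left' (f := fun z : Ω' × ℝ => survival z.2 (T k z.1))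
    (measurable_survival.comp (measurable_snd.prodMk ((h.measurable_time k).comp measurable_fst)))

theorem measurable_kernel_mul_occupation [IsProbabilityMeasure Pr] (k : ℕ) (x y : E) :
    Measurable fun τ => ENNReal.ofReal (p τ x y) * occupation Pr χ T k x τ :=
  (h.continuous_kernel x y).measurable.ennreal_ofReal.mul (h.measurable_occupation k x)

/-- This identifies `occupation` with its probabilistic meaning; strict and weak inequalities at `t`
can be exchanged because the jump times after the first have no atoms. -/
theorem measure_state_between [IsProbabilityMeasure Pr] (k : ℕ) (x : E) {t : ℝ} (ht : 0 ≤ t) :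
    Pr {ω | χ k ω = x ∧ T k ω ≤ t ∧ t < T (k + 1) ω} = occupation Pr χ T k x t := by
  have hA : MeasurableSet[past χ T k] ({ω | χ k ω = x} ∩ T k ⁻¹' Set.Iic t) :=
    (measurableSet_past_state χ T k x).inter (measurableSet_past_time χ T k measurableSet_Iic)
  have hA' := h.past_le k _ hA
  calc _ = Pr ({ω | χ k ω = x} ∩ T k ⁻¹' Set.Iic t ∩ {ω | t ≤ T (k + 1) ω}) := by
        refine measure_congr ?_
        filter_upwards [measure_eq_zero_iff_ae_notMem.mp (h.measure_time_eq k t)] with ω hω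
        refine propext ⟨fun ⟨h1, h2, h3⟩ => ⟨⟨h1, h2⟩, h3.le⟩, fun ⟨⟨h1, h2⟩, h3⟩ =>
          ⟨h1, h2, lt_of_le_of_ne h3 fun h4 => hω h4.symm⟩⟩
    _ = ∫⁻ ω in {ω | χ k ω = x} ∩ T k ⁻¹' Set.Iic t, survival t (T k ω) ∂Pr := by
        rw [h.measure_inter_le_time hA ht]
        refine setLIntegral_congr_fun hA' fun ω hω => ?_
        have h1 : T k ω ≤ t := hω.2
        simp [survival, h1]
    _ = _ := by
        rw [occupation, Set.inter_comm, ← setLIntegral_indicator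
          (h.measurable_time k measurableSet_Iic)]
        refine lintegral_congr fun ω => ?_
        by_cases h1 : T k ω ≤ t <;> simp [survival, h1]

theorem measure_state_time_le [IsProbabilityMeasure Pr] (k : ℕ) (y : E) (t : ℝ) :
    Pr {ω | χ (k + 1) ω = y ∧ T (k + 1) ω ≤ t} = ∫⁻ τ in Set.Icc 0 t,
      ∑ x, ENNReal.ofReal (p τ x y) * occupation Pr χ T k x τ := by
  have hm : MeasurableSet {ω | χ (k + 1) ω = y ∧ T (k + 1) ω ≤ t} :=
    (h.measurable_state _ _).inter (measurableSet_le (h.measurable_time _) measurable_const)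
  rw [h.measure_eq_sum_state k hm, lintegral_finsetSum _ fun x _ =>
    h.measurable_kernel_mul_occupation k x y]
  refine Finset.sum_congr rfl fun x _ => ?_
  have h1 := h.measure_inter_state_time (measurableSet_past_state χ T k x) y
    (measurableSet_Iic (a := t))
  rw [Set.inter_comm (Set.Iic t), Set.Ici_inter_Iic] at h1
  convert! h1 using 1
  · congr 1
    ext ω
    simp only [Set.mem_inter_iff, Set.mem_preimage, Set.mem_Iic, Set.mem_ofPred_eq]
    tauto
  · refine lintegral_congr fun τ => ?_
    have hs : Measurable fun ω => survival τ (T k ω) :=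
      measurable_survival.comp (measurable_const.prodMk (h.measurable_time k))
    rw [occupation, ← lintegral_const_mul _ hs]
    refine setLIntegral_congr_fun (h.measurable_state k x) fun ω hω => ?_
    rw [show χ k ω = x from hω]

theorem measure_state_next_time_le [IsProbabilityMeasure Pr] (k : ℕ) (x : E) (t : ℝ) :
    Pr {ω | χ k ω = x ∧ T (k + 1) ω ≤ t} = ∫⁻ τ in Set.Icc 0 t, occupation Pr χ T k x τ := by
  have h1 := h.measure_inter_time (measurableSet_past_state χ T k x) (measurableSet_Iic (a := t))
  rw [Set.inter_comm (Set.Iic t), Set.Ici_inter_Iic] at h1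
  exact h1

/-- A visit begun by time `t` is either still in progress at `t` or already finished. The balance is
kept as a sum, so that no subtraction in `[0, ∞]` is needed. -/
theorem occupation_add [IsProbabilityMeasure Pr] (k : ℕ) (x : E) {t : ℝ} (ht : 0 ≤ t) :
    occupation Pr χ T k x t + ∫⁻ τ in Set.Icc 0 t, occupation Pr χ T k x τ
      = Pr {ω | χ k ω = x ∧ T k ω ≤ t} := by
  rw [← h.measure_state_next_time_le, ← h.measure_state_between k x ht, ← measure_union]
  · refine measure_congr ?_
    filter_upwards [h.time_mono k] with ω hω
    refine propext ⟨?_, fun ⟨h1, h2⟩ => ?_⟩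
    · rintro (⟨h1, h2, -⟩ | ⟨h1, h2⟩)
      exacts [⟨h1, h2⟩, ⟨h1, hω.trans h2⟩]
    · rcases lt_or_ge t (T (k + 1) ω) with h3 | h3
      exacts [Or.inl ⟨h1, h2, h3⟩, Or.inr ⟨h1, h3⟩]
  · exact Set.disjoint_left.mpr fun ω h1 h2 => not_lt.mpr h2.2 h1.2.2
  · exact (h.measurable_state _ _).inter (measurableSet_le (h.measurable_time _) measurable_const)

omit h in
/-- The probability of being in the state `x` at time `t`. -/
noncomputable def law (Pr : Measure Ω') (χ : ℕ → Ω' → E) (T : ℕ → Ω' → ℝ) (x : E) (t : ℝ) :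
    ℝ≥0∞ := ∑' k, occupation Pr χ T k x t

theorem measurable_law [IsProbabilityMeasure Pr] (x : E) : Measurable (law Pr χ T x) :=
  Measurable.tsum fun k => h.measurable_occupation k x

/-- The forward equation. -/
theorem law_add [IsProbabilityMeasure Pr] (y : E) {t : ℝ} (ht : 0 ≤ t) :
    law Pr χ T y t + ∫⁻ τ in Set.Icc 0 t, law Pr χ T y τ
      = Pr {ω | χ 0 ω = y} + ∫⁻ τ in Set.Icc 0 t,
        ∑ x, ENNReal.ofReal (p τ x y) * law Pr χ T x τ := by
  have h1 : ∀ τ, ∑ x, ENNReal.ofReal (p τ x y) * law Pr χ T x τ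
      = ∑' k, ∑ x, ENNReal.ofReal (p τ x y) * occupation Pr χ T k x τ := fun τ => by
    simp only [law]
    rw [Summable.tsum_finsetSum fun _ _ => ENNReal.summable]
    simp_rw [ENNReal.tsum_mul_left]
  simp_rw [h1]
  rw [lintegral_tsum fun k => (Finset.measurable_fun_sum _ fun x _ =>
    h.measurable_kernel_mul_occupation k x y).aemeasurable]
  simp only [law]
  rw [lintegral_tsum fun k => (h.measurable_occupation k y).aemeasurable, ← ENNReal.tsum_add]
  simp_rw [h.occupation_add _ y ht]
  -- The term `k = 0` is the initial law, as `T 0 = 0`; the later terms are the inflows by jumps.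
  rw [tsum_eq_zero_add' ENNReal.summable]
  simp_rw [h.measure_state_time_le _ y t]
  congr 1
  refine measure_congr ?_
  filter_upwards [h.start_time] with ω hω
  exact propext ⟨fun h1 => h1.1, fun h1 => ⟨h1, hω.trans_le ht⟩⟩

theorem sum_occupation_add [IsProbabilityMeasure Pr] (k : ℕ) {t : ℝ} (ht : 0 ≤ t) :
    ∑ x, occupation Pr χ T k x t + Pr {ω | T (k + 1) ω ≤ t} = Pr {ω | T k ω ≤ t} := by
  rw [h.measure_eq_sum_state k (A := {ω | T k ω ≤ t})
      (measurableSet_le (h.measurable_time _) measurable_const),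
    h.measure_eq_sum_state k (A := {ω | T (k + 1) ω ≤ t})
      (measurableSet_le (h.measurable_time _) measurable_const), ← Finset.sum_add_distrib]
  refine Finset.sum_congr rfl fun x _ => ?_
  have h1 : ∀ j, {ω | T j ω ≤ t} ∩ {ω | χ k ω = x} = {ω | χ k ω = x ∧ T j ω ≤ t} := fun j => by
    ext ω; simp [and_comm]
  rw [h1, h1, h.measure_state_next_time_le, h.occupation_add k x ht]

theorem sum_range_occupation_add [IsProbabilityMeasure Pr] (n : ℕ) {t : ℝ} (ht : 0 ≤ t) :
    ∑ k ∈ Finset.range n, ∑ x, occupation Pr χ T k x t + Pr {ω | T n ω ≤ t} = 1 := by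
  induction n with
  | zero =>
    rw [Finset.sum_range_zero, zero_add, ← mem_ae_iff_prob_eq_one
      (measurableSet_le (h.measurable_time _) measurable_const)]
    filter_upwards [h.start_time] with ω hω using hω.trans_le ht
  | succ n ih => rw [Finset.sum_range_succ, add_assoc, h.sum_occupation_add n ht, ih]

theorem tsum_occupation_le [IsProbabilityMeasure Pr] {t : ℝ} (ht : 0 ≤ t) :
    ∑' k, ∑ x, occupation Pr χ T k x t ≤ 1 := by
  rw [ENNReal.tsum_eq_iSup_nat]
  exact iSup_le fun n => le_self_add.trans (h.sum_range_occupation_add n ht).le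

/-- The chain does not explode. -/
theorem tendsto_measure_time_le [IsProbabilityMeasure Pr] (t : ℝ) :
    Tendsto (fun k => Pr {ω | T k ω ≤ t}) atTop (𝓝 0) := by
  rw [← tendsto_add_atTop_iff_nat 1]
  have h1 : ∀ k, Pr {ω | T (k + 1) ω ≤ t}
      = ∫⁻ τ in Set.Icc 0 t, ∑ x, occupation Pr χ T k x τ := fun k => by
    rw [h.measure_eq_sum_state k (A := {ω | T (k + 1) ω ≤ t})
      (measurableSet_le (h.measurable_time _) measurable_const),
      lintegral_finsetSum _ fun x _ => h.measurable_occupation k x]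
    refine Finset.sum_congr rfl fun x _ => ?_
    rw [← h.measure_state_next_time_le]
    congr 1; ext ω; simp [and_comm]
  simp_rw [h1]
  -- The integrands are the terms of a series in `k` with sum at most `1`, so they tend to zero
  -- pointwise and are dominated by `1`.
  have h2 := tendsto_lintegral_of_dominated_convergence
    (μ := volume.restrict (Set.Icc 0 t)) (F := fun k τ => ∑ x, occupation Pr χ T k x τ)
    (f := fun _ => 0) (fun _ => 1)
    (fun k => Finset.measurable_sum _ fun x _ => h.measurable_occupation k x)
    (fun k => (ae_restrict_mem measurableSet_Icc).mono fun τ hτ =>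
      (ENNReal.le_tsum (f := fun k => ∑ x, occupation Pr χ T k x τ) k).trans
        (h.tsum_occupation_le hτ.1))
    (by simp) ((ae_restrict_mem measurableSet_Icc).mono fun τ hτ =>
      ENNReal.tendsto_atTop_zero_of_tsum_ne_top
        (ne_top_of_le_ne_top ENNReal.one_ne_top (h.tsum_occupation_le hτ.1)))
  simpa using h2

/-- The partial sums over `k < n` fall short of `1` by the probability of `T n ≤ t`, which vanishes
in the limit by non-explosion. -/
theorem sum_law [IsProbabilityMeasure Pr] {t : ℝ} (ht : 0 ≤ t) : ∑ x, law Pr χ T x t = 1 := by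
  simp only [law]
  rw [← Summable.tsum_finsetSum fun _ _ => ENNReal.summable]
  have h1 := (ENNReal.tendsto_nat_tsum fun k => ∑ x, occupation Pr χ T k x t).add
    (h.tendsto_measure_time_le t)
  simp_rw [h.sum_range_occupation_add _ ht, add_zero] at h1
  exact (tendsto_nhds_unique tendsto_const_nhds h1).symm

theorem law_le_one [IsProbabilityMeasure Pr] (x : E) {t : ℝ} (ht : 0 ≤ t) : law Pr χ T x t ≤ 1 := by
  rw [← h.sum_law ht]
  exact Finset.single_le_sum (f := fun x => law Pr χ T x t) (fun _ _ => zero_le) (Finset.mem_univ x)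

/-- Almost surely some interval `[T_k, T_{k+1})` contains `t`. Only an upper bound is claimed, so
subadditivity of the outer measure suffices and `X t` need not be measurable. -/
theorem measure_process_le [IsProbabilityMeasure Pr] {X : ℝ → Ω' → E}
    (hX : ∀ᵐ ω ∂Pr, ∀ t : ℝ, 0 ≤ t → ∀ k, T k ω ≤ t → t < T (k + 1) ω → X t ω = χ k ω)
    {t : ℝ} (ht : 0 ≤ t) (A : Set E) :
    Pr {ω | X t ω ∈ A} ≤ ∑ x, A.indicator (fun x => law Pr χ T x t) x := by
  classical
  have hnull : Pr {ω | ∀ k, T k ω ≤ t} = 0 :=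
    le_antisymm (ge_of_tendsto' (h.tendsto_measure_time_le t) fun k =>
      measure_mono fun ω hω => hω k) zero_le
  have hsub : {ω | X t ω ∈ A} ≤ᵐ[Pr] ⋃ x ∈ Finset.univ.filter (· ∈ A),
      ⋃ k, {ω | χ k ω = x ∧ T k ω ≤ t ∧ t < T (k + 1) ω} := by
    filter_upwards [hX, h.start_time, measure_eq_zero_iff_ae_notMem.mp hnull] with ω h1 h2 h3 h4
    have hex : ∃ k, T k ω ≤ t ∧ t < T (k + 1) ω := by
      by_contra! hcon
      refine h3 fun k => ?_
      induction k with
      | zero => exact h2.trans_le ht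
      | succ k ih => exact hcon k ih
    obtain ⟨k, hk1, hk2⟩ := hex
    have h5 := h1 t ht k hk1 hk2
    have h4' : X t ω ∈ A := h4
    refine Set.mem_biUnion (x := χ k ω) ?_ (Set.mem_iUnion.mpr ⟨k, rfl, hk1, hk2⟩)
    simpa [h5] using h4'
  refine (measure_mono_ae hsub).trans ((measure_biUnion_finset_le _ _).trans ?_)
  rw [Finset.sum_filter]
  refine Finset.sum_le_sum fun x _ => ?_
  by_cases hx : x ∈ A
  · rw [if_pos hx, Set.indicator_of_mem hx, law]
    refine (measure_iUnion_le _).trans (le_of_eq ?_)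
    simp_rw [h.measure_state_between _ x ht]
  · rw [if_neg hx]; exact zero_le

theorem state_mem [IsProbabilityMeasure Pr] {F : Set E} (h0 : ∀ᵐ ω ∂Pr, χ 0 ω ∈ F)
    (hF : ∀ τ x y, x ∈ F → y ∉ F → p τ x y = 0) (k : ℕ) : ∀ᵐ ω ∂Pr, χ k ω ∈ F := by
  induction k with
  | zero => exact h0
  | succ k ih =>
    have h1 : ∀ y : E, ∀ᵐ ω ∂Pr, y ∉ F → χ (k + 1) ω ≠ y := fun y => by
      by_cases hy : y ∈ F
      · exact ae_of_all _ fun ω hn => absurd hy hn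
      have h2 := h.markov_rate (k := k) (A := Set.univ) MeasurableSet.univ y le_rfl
      have h3 : ∫⁻ ω in Set.univ, (∫⁻ τ in Set.Ici (0 : ℝ),
          ENNReal.ofReal (p τ (χ k ω) y) * survival τ (T k ω)) ∂Pr = 0 := by
        rw [Measure.restrict_univ, lintegral_congr_ae (g := fun _ => 0), lintegral_zero]
        filter_upwards [ih] with ω hω
        simp [hF _ _ _ hω hy]
      rw [h3, Set.univ_inter] at h2
      filter_upwards [measure_eq_zero_iff_ae_notMem.mp h2, h.time_nonneg (k + 1)] with ω h4 h5 _ h6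
      exact h4 ⟨h6, h5⟩
    filter_upwards [ae_all_iff.mpr h1] with ω hω
    by_contra hn
    exact hω _ hn rfl

theorem law_eq_zero [IsProbabilityMeasure Pr] {F : Set E} (h0 : ∀ᵐ ω ∂Pr, χ 0 ω ∈ F)
    (hF : ∀ τ x y, x ∈ F → y ∉ F → p τ x y = 0) {x : E} (hx : x ∉ F) (t : ℝ) :
    law Pr χ T x t = 0 := by
  rw [law, ENNReal.tsum_eq_zero]
  intro k
  have h1 : Pr {ω | χ k ω = x} = 0 := by
    rw [measure_eq_zero_iff_ae_notMem]
    filter_upwards [h.state_mem h0 hF k] with ω hω h2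
    exact hx (h2 ▸ hω)
  rw [occupation, Measure.restrict_eq_zero.mpr h1, lintegral_zero_measure]

/-- The forward equation in differential form. -/
theorem hasDerivAt_law [IsProbabilityMeasure Pr] (y : E) {t : ℝ} (ht : 0 < t) :
    HasDerivAt (fun t => (law Pr χ T y t).toReal)
      (∑ x, p t x y * (law Pr χ T x t).toReal - (law Pr χ T y t).toReal) t := by
  set m : E → ℝ → ℝ := fun x τ => (law Pr χ T x τ).toReal with hm
  set F : E → ℝ → ℝ := fun y τ => ∑ x, p τ x y * m x τ - m y τ with hF
  have hm_meas : ∀ x, Measurable (m x) := fun x => (h.measurable_law x).ennreal_toReal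
  have hm_bd : ∀ x τ, 0 ≤ τ → |m x τ| ≤ 1 := fun x τ hτ => by
    rw [abs_of_nonneg ENNReal.toReal_nonneg]
    exact ENNReal.toReal_mono ENNReal.one_ne_top (h.law_le_one x hτ)
  have hm_int : ∀ x s, IntegrableOn (m x) (Set.Icc 0 s) := fun x s =>
    Measure.integrableOn_of_bounded (M := 1) (by simp) (hm_meas x).aestronglyMeasurable
      ((ae_restrict_mem measurableSet_Icc).mono fun τ hτ => hm_bd x τ hτ.1)
  have hpm_int : ∀ x y s, IntegrableOn (fun τ => p τ x y * m x τ) (Set.Icc 0 s) := fun x y s =>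
    (hm_int x s).continuousOn_mul (h.continuous_kernel x y).continuousOn isCompact_Icc
  have hsum_int : ∀ y s, IntegrableOn (fun τ => ∑ x, p τ x y * m x τ) (Set.Icc 0 s) := fun y s =>
    integrable_finsetSum _ fun x _ => hpm_int x y s
  have hF_int : ∀ y s, IntegrableOn (F y) (Set.Icc 0 s) := fun y s =>
    (hsum_int y s).sub (hm_int y s)
  have hfin : ∀ x τ, 0 ≤ τ → law Pr χ T x τ < ⊤ := fun x τ hτ =>
    (h.law_le_one x hτ).trans_lt ENNReal.one_lt_top
  have heq : ∀ y s, 0 ≤ s → m y s = Pr.real {ω | χ 0 ω = y} + ∫ τ in (0 : ℝ)..s, F y τ := by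
    intro y s hs
    have h1 : ∫⁻ τ in Set.Icc 0 s, law Pr χ T y τ = ENNReal.ofReal (∫ τ in Set.Icc 0 s, m y τ) := by
      rw [ofReal_integral_eq_lintegral_ofReal (hm_int y s)
        (ae_of_all _ fun τ => ENNReal.toReal_nonneg)]
      exact setLIntegral_congr_fun measurableSet_Icc fun τ hτ =>
        (ENNReal.ofReal_toReal (hfin y τ hτ.1).ne).symm
    have h2 : ∫⁻ τ in Set.Icc 0 s, ∑ x, ENNReal.ofReal (p τ x y) * law Pr χ T x τ
        = ENNReal.ofReal (∫ τ in Set.Icc 0 s, ∑ x, p τ x y * m x τ) := by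
      rw [ofReal_integral_eq_lintegral_ofReal (hsum_int y s) (ae_of_all _ fun τ =>
        Finset.sum_nonneg fun x _ => mul_nonneg (h.kernel_nonneg τ x y) ENNReal.toReal_nonneg)]
      refine setLIntegral_congr_fun measurableSet_Icc fun τ hτ => ?_
      rw [ENNReal.ofReal_sum_of_nonneg fun x _ =>
        mul_nonneg (h.kernel_nonneg τ x y) ENNReal.toReal_nonneg]
      refine Finset.sum_congr rfl fun x _ => ?_
      rw [ENNReal.ofReal_mul (h.kernel_nonneg τ x y), ENNReal.ofReal_toReal (hfin x τ hτ.1).ne]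
    have h3 := h.law_add y hs
    rw [h1, h2] at h3
    have h4 := congrArg ENNReal.toReal h3
    rw [ENNReal.toReal_add (hfin y s hs).ne ENNReal.ofReal_ne_top,
      ENNReal.toReal_add (measure_ne_top _ _) ENNReal.ofReal_ne_top,
      ENNReal.toReal_ofReal (integral_nonneg fun τ => ENNReal.toReal_nonneg),
      ENNReal.toReal_ofReal (integral_nonneg fun τ => Finset.sum_nonneg fun x _ =>
        mul_nonneg (h.kernel_nonneg τ x y) ENNReal.toReal_nonneg)] at h4
    rw [intervalIntegral.integral_of_le hs, ← integral_Icc_eq_integral_Ioc]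
    simp only [hF]
    rw [integral_sub (hsum_int y s) (hm_int y s)]
    simp only [Measure.real, hm] at h4 ⊢
    linarith
  -- Bootstrap: the integral equation `heq` makes `m` continuous, hence its integrand `F`
  -- continuous, hence `m` differentiable.
  have hcont : ∀ x, ContinuousAt (m x) t := fun x => by
    have h1 : ContinuousOn (fun s => ∫ τ in (0 : ℝ)..s, F x τ) (Set.Icc 0 (t + 1)) := by
      have hle : (0 : ℝ) ≤ t + 1 := by linarith
      rw [← Set.uIcc_of_le hle]
      refine intervalIntegral.continuousOn_primitive_interval ?_
      rw [Set.uIcc_of_le hle]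
      exact hF_int x (t + 1)
    have h2 : Set.Icc 0 (t + 1) ∈ 𝓝 t := Icc_mem_nhds ht (by linarith)
    refine ((continuousAt_const (y := Pr.real {ω | χ 0 ω = x})).add
      (h1.continuousAt h2)).congr ?_
    filter_upwards [h2] with s hs using (heq x s hs.1).symm
  have hFcont : ContinuousAt (F y) t :=
    (tendsto_finsetSum _ fun x _ =>
      ((h.continuous_kernel x y).continuousAt.mul (hcont x))).sub (hcont y)
  have hderiv := (intervalIntegral.integral_hasDerivAt_right (a := 0) (b := t) (f := F y)
    ((intervalIntegrable_iff_integrableOn_Icc_of_le ht.le).mpr (hF_int y t))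
    (Measurable.stronglyMeasurable (by
      have := fun x => (h.continuous_kernel x y).measurable
      simp only [hF]
      fun_prop)).stronglyMeasurableAtFilter hFcont).const_add (Pr.real {ω | χ 0 ω = y})
  refine hderiv.congr_of_eventuallyEq ?_
  filter_upwards [Ioi_mem_nhds ht] with s hs using heq y s (le_of_lt hs)

end IsJumpChain

end NoisyAnnealing
-- Evolution of the second moment of the density.
namespace NoisyAnnealing

open Filter Topology

theorem cooling_nonneg {b d t : ℝ} (hb : 0 ≤ b) (hd : 0 ≤ d) (ht : 0 ≤ t) : 0 ≤ cooling b d t :=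
  mul_nonneg hb (Real.log_nonneg (by nlinarith [mul_nonneg ht hd]))

theorem cooling_mono {b d s t : ℝ} (hb : 0 ≤ b) (hd : 0 ≤ d) (hs : 0 ≤ s) (hst : s ≤ t) :
    cooling b d s ≤ cooling b d t := by
  unfold cooling
  have := mul_nonneg hs hd
  gcongr

theorem hasDerivAt_cooling (b : ℝ) {d t : ℝ} (ht : 0 < t * d + 1) :
    HasDerivAt (cooling b d) (b * d / (t * d + 1)) t := by
  have h := ((((hasDerivAt_id t).mul_const d).add_const 1).log ht.ne').const_mul b
  refine h.congr_deriv ?_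
  simp [mul_div_assoc]

theorem exp_neg_mul_cooling (m b : ℝ) {d t : ℝ} (ht : 0 < t * d + 1) :
    Real.exp (-(m * cooling b d t)) = (t * d + 1) ^ (-(m * b)) := by
  rw [Real.rpow_def_of_pos ht, cooling]
  ring_nf

theorem hasDerivAt_boltz (s : ℝ≥0∞) (β : ℝ) :
    HasDerivAt (fun β => boltz β s) (-s.toReal * boltz β s) β := by
  by_cases hs : s = ⊤
  · simpa [boltz, hs] using hasDerivAt_const β (0 : ℝ)
  · simp only [boltz, hs, if_false]
    convert! (((hasDerivAt_id β).mul_const s.toReal).neg).exp using 1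
    simp; ring

namespace Setting

variable {E Ω : Type*} [Fintype E] [DecidableEq E] [MeasurableSpace Ω] (𝒮 : Setting E Ω)

/-- The mean cost under the Gibbs distribution. -/
noncomputable def gibbsCost (w : E → ℝ) (β : ℝ) : ℝ := ∑ x, 𝒮.cost x * 𝒮.gibbs w β x

/-- Logarithmic derivative of a Gibbs weight: mean cost minus cost. Outside `E'`, where `cost` is
`0` by the convention of `toReal`, the weight vanishes and the formula remains valid. -/
theorem hasDerivAt_gibbs {w : E → ℝ} {β : ℝ} (hZ : 𝒮.partition w β ≠ 0) (x : E) :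
    HasDerivAt (fun β => 𝒮.gibbs w β x)
      ((𝒮.gibbsCost w β - 𝒮.cost x) * 𝒮.gibbs w β x) β := by
  have h1 : ∀ z, HasDerivAt (fun β => w z * boltz β (𝒮.J z))
      (w z * (-𝒮.cost z * boltz β (𝒮.J z))) β := fun z => (hasDerivAt_boltz _ _).const_mul _
  have h2 : HasDerivAt (𝒮.partition w) (∑ z, w z * (-𝒮.cost z * boltz β (𝒮.J z))) β :=
    HasDerivAt.fun_sum fun z _ => h1 z
  have h3 : ∑ z, w z * (-𝒮.cost z * boltz β (𝒮.J z))
      = -(𝒮.gibbsCost w β * 𝒮.partition w β) := by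
    rw [gibbsCost, Finset.sum_mul, ← Finset.sum_neg_distrib]
    refine Finset.sum_congr rfl fun z _ => ?_
    rw [gibbs_eq]
    field_simp
  convert! (h1 x).div h2 hZ using 1
  rw [h3, gibbs_eq]
  field_simp
  ring

theorem qTilde_sum (β : ℝ) (r : ℝ≥0) (x : E) : ∑ y, 𝒮.qTilde β r x y = 1 := by
  rw [← Finset.add_sum_erase _ _ (Finset.mem_univ x)]
  have : ∑ y ∈ Finset.univ.erase x, 𝒮.qTilde β r x y
      = ∑ z ∈ Finset.univ.erase x, 𝒮.q₀ x z * 𝒮.accept β r x z :=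
    Finset.sum_congr rfl fun y hy => by rw [qTilde, if_neg (Finset.ne_of_mem_erase hy)]
  rw [this, qTilde, if_pos rfl, sub_add_cancel]

theorem sum_erase_q₀_mul_le_one {a : E → ℝ} (ha : ∀ y, a y ≤ 1) (x : E) :
    ∑ y ∈ Finset.univ.erase x, 𝒮.q₀ x y * a y ≤ 1 := by
  rw [← 𝒮.q₀_sum x]
  refine (Finset.sum_le_sum fun y _ => mul_le_of_le_one_right (𝒮.q₀_nonneg x y) (ha y)).trans ?_
  exact Finset.sum_le_sum_of_subset_of_nonneg (Finset.erase_subset _ _)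
    fun y _ _ => 𝒮.q₀_nonneg x y

theorem qTilde_nonneg {β : ℝ} (hβ : 0 ≤ β) (r : ℝ≥0) (x y : E) : 0 ≤ 𝒮.qTilde β r x y := by
  unfold qTilde
  split_ifs
  · exact sub_nonneg.mpr (𝒮.sum_erase_q₀_mul_le_one (fun z => 𝒮.accept_le_one hβ r x z) x)
  · exact mul_nonneg (𝒮.q₀_nonneg x y) (𝒮.accept_nonneg β r x y)

theorem qTilde_eq_zero (β : ℝ) (r : ℝ≥0) {x y : E} (hx : x ∈ 𝒮.E') (hy : y ∉ 𝒮.E') :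
    𝒮.qTilde β r x y = 0 := by
  rw [qTilde, if_neg (show y ≠ x from fun h => hy (h ▸ hx)), 𝒮.accept_eq_zero β r hx hy, mul_zero]

/-- The kernel of noisy annealing, constant before time zero. -/
noncomputable def noisyKernel (b d α τ : ℝ) (x y : E) : ℝ :=
  𝒮.qTilde (cooling b d (max τ 0)) (intensity α (max τ 0)) x y

theorem continuous_noisyKernel (b d α : ℝ) (hb : 0 ≤ b) (hd : 0 ≤ d) (x y : E) :
    Continuous fun τ => 𝒮.noisyKernel b d α τ x y := by
  have hβ : Continuous fun τ : ℝ => cooling b d (max τ 0) := by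
    unfold cooling
    refine continuous_const.mul (Continuous.log (by fun_prop) fun τ => ?_)
    have := mul_nonneg (le_max_right τ 0) hd
    positivity
  have hr : Continuous fun τ : ℝ => ((intensity α (max τ 0) : ℝ≥0) : ℝ) := by
    unfold intensity
    refine NNReal.continuous_coe.comp (continuous_real_toNNReal.comp ?_)
    refine Continuous.rpow_const (by fun_prop) fun τ => Or.inl ?_
    have := le_max_right τ 0
    positivity
  have ha : ∀ z, Continuous fun τ =>
      𝒮.accept (cooling b d (max τ 0)) (intensity α (max τ 0)) x z := fun z => by
    refine continuous_iff_continuousAt.mpr fun τ => ?_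
    exact (𝒮.continuousOn_accept (isCompact_Icc (a := τ - 1) (b := τ + 1)) hβ.continuousOn
      (fun t _ => cooling_nonneg hb hd (le_max_right t 0)) hr.continuousOn x z).continuousAt
      (Icc_mem_nhds (by linarith) (by linarith))
  unfold noisyKernel qTilde
  split_ifs
  · exact continuous_const.sub (continuous_finsetSum _ fun z _ => continuous_const.mul (ha z))
  · exact continuous_const.mul (ha y)

theorem isJumpChain {b d α : ℝ} (hb : 0 ≤ b) (hd : 0 ≤ d) {Ω' : Type*} [MeasurableSpace Ω']
    {Pr : Measure Ω'} {χ : ℕ → Ω' → E} {T : ℕ → Ω' → ℝ} {X : ℝ → Ω' → E}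
    (hX : IsNSA 𝒮 b d α Pr χ T X) : IsJumpChain (𝒮.noisyKernel b d α) Pr χ T where
  continuous_kernel := 𝒮.continuous_noisyKernel b d α hb hd
  kernel_nonneg τ x y := 𝒮.qTilde_nonneg (cooling_nonneg hb hd (le_max_right τ 0)) _ x y
  kernel_sum τ x := 𝒮.qTilde_sum _ _ x
  measurable_state := hX.measurable_state
  measurable_time := hX.measurable_time
  start_time := hX.start_time
  markov k A hA y u hu := by
    rw [hX.markov k A hA y u hu]
    refine lintegral_congr fun ω => setLIntegral_congr_fun
      (measurableSet_Ici.inter measurableSet_Ici) fun τ hτ => ?_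
    have : 0 ≤ τ := hu.trans hτ.1
    rw [noisyKernel, max_eq_left this]

/-- The Dirichlet form of noisy annealing is close to that of noise-free annealing. -/
theorem sum_mul_qTilde_le {β : ℝ} (hβ : 0 ≤ β) {r : ℝ≥0} {η : ℝ} (hη : 0 ≤ η)
    (hacc : ∀ x ∈ 𝒮.E', ∀ y ∈ 𝒮.E', |𝒮.accept β r x y - boltz β (𝒮.J y - 𝒮.J x)|
      ≤ boltz β (𝒮.J y - 𝒮.J x) * η) (f : E → ℝ) :
    ∑ x, ∑ y, 𝒮.gibbs 𝒮.μ₀ β x * f x * ((f y - f x) * 𝒮.qTilde β r x y)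
      ≤ -𝒮.energy β f + 2 * η * ∑ x, f x ^ 2 * 𝒮.gibbs 𝒮.μ₀ β x := by
  set w := 𝒮.gibbs 𝒮.μ₀ β with hw
  have hw0 : ∀ x, 0 ≤ w x := 𝒮.gibbs_nonneg 𝒮.μ₀_nonneg β
  -- The off-diagonal Gibbs flow. The diagonal is dropped because it does not contribute to the form
  -- and its error is not controlled by `η`.
  set k : E → E → ℝ := fun x y => if y = x then 0 else w x * 𝒮.q β x y with hk
  have hk0 : ∀ x y, 0 ≤ k x y := fun x y => by
    simp only [hk]
    split_ifs with hxy
    exacts [le_rfl, mul_nonneg (hw0 x) (𝒮.q_nonneg β hxy)]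
  have hk_comm : ∀ x y, k x y = k y x := fun x y => by
    simp only [hk]
    by_cases hxy : y = x
    · simp [hxy]
    · rw [if_neg hxy, if_neg (Ne.symm hxy), hw, 𝒮.gibbs_mul_q_comm]
  have hk_sum : ∀ x, ∑ y, k x y ≤ w x := fun x => by
    have h1 : ∑ y, k x y
        = w x * ∑ y ∈ Finset.univ.erase x, 𝒮.q₀ x y * boltz β (𝒮.J y - 𝒮.J x) := by
      rw [← Finset.add_sum_erase _ _ (Finset.mem_univ x), Finset.mul_sum]
      simp only [hk, if_true, zero_add]
      refine Finset.sum_congr rfl fun y hy => ?_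
      rw [if_neg (Finset.ne_of_mem_erase hy), q, if_neg (Finset.ne_of_mem_erase hy)]
    rw [h1]
    exact mul_le_of_le_one_right (hw0 x)
      (𝒮.sum_erase_q₀_mul_le_one (fun y => boltz_le_one hβ _) x)
  have hterm : ∀ x y, w x * f x * ((f y - f x) * 𝒮.qTilde β r x y)
      ≤ w x * f x * ((f y - f x) * 𝒮.q β x y)
        + η * (k x y * (3 / 2 * f x ^ 2) + k x y * (1 / 2 * f y ^ 2)) := fun x y => by
    by_cases hxy : y = x
    · simp [hxy, hk]
    have hdiff : |w x * (𝒮.qTilde β r x y - 𝒮.q β x y)| ≤ η * k x y := by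
      by_cases hx : x ∈ 𝒮.E'
      swap
      · rw [hw, 𝒮.gibbs_eq_zero _ β hx, zero_mul, abs_zero]
        exact mul_nonneg hη (hk0 x y)
      by_cases hy : y ∈ 𝒮.E'
      swap
      · rw [𝒮.qTilde_eq_zero β r hx hy, q, if_neg hxy, 𝒮.boltz_J_sub_eq_zero β hx hy]
        simpa using mul_nonneg hη (hk0 x y)
      simp only [hk]
      rw [if_neg hxy, qTilde, q, if_neg hxy, if_neg hxy, ← mul_sub, abs_mul, abs_mul,
        abs_of_nonneg (hw0 x), abs_of_nonneg (𝒮.q₀_nonneg x y)]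
      calc _ ≤ w x * (𝒮.q₀ x y * (boltz β (𝒮.J y - 𝒮.J x) * η)) :=
            mul_le_mul_of_nonneg_left (mul_le_mul_of_nonneg_left (hacc x hx y hy)
              (𝒮.q₀_nonneg x y)) (hw0 x)
        _ = _ := by ring
    have hf : |f x * (f y - f x)| ≤ 3 / 2 * f x ^ 2 + 1 / 2 * f y ^ 2 := by
      rw [abs_le]
      constructor <;> nlinarith [sq_nonneg (f x - f y), sq_nonneg (f x + f y), sq_nonneg (f x)]
    have h1 : w x * f x * ((f y - f x) * 𝒮.qTilde β r x y)
        - w x * f x * ((f y - f x) * 𝒮.q β x y)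
        = (w x * (𝒮.qTilde β r x y - 𝒮.q β x y)) * (f x * (f y - f x)) := by ring
    have h2 := (le_abs_self ((w x * (𝒮.qTilde β r x y - 𝒮.q β x y)) * (f x * (f y - f x)))).trans
      ((abs_mul _ _).trans_le (mul_le_mul hdiff hf (abs_nonneg _) (mul_nonneg hη (hk0 x y))))
    linarith
  have hfst : ∑ x, ∑ y, k x y * (3 / 2 * f x ^ 2) ≤ 3 / 2 * ∑ x, f x ^ 2 * w x := by
    rw [Finset.mul_sum]
    refine Finset.sum_le_sum fun x _ => ?_
    rw [← Finset.sum_mul]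
    nlinarith [mul_le_mul_of_nonneg_right (hk_sum x) (sq_nonneg (f x))]
  -- The column sums are bounded through reversibility; here the relative form of the error is
  -- essential. The weights `3/2` and `1/2` add up to the constant `2`.
  have hsnd : ∑ x, ∑ y, k x y * (1 / 2 * f y ^ 2) ≤ 1 / 2 * ∑ x, f x ^ 2 * w x := by
    rw [Finset.sum_comm, Finset.mul_sum]
    refine Finset.sum_le_sum fun x _ => ?_
    simp_rw [fun y => hk_comm y x]
    rw [← Finset.sum_mul]
    nlinarith [mul_le_mul_of_nonneg_right (hk_sum x) (sq_nonneg (f x))]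
  have henergy : ∑ x, ∑ y, w x * f x * ((f y - f x) * 𝒮.q β x y) = -𝒮.energy β f := by
    rw [← 𝒮.neg_sum_mul_L_eq, neg_neg]
    refine Finset.sum_congr rfl fun x _ => ?_
    rw [L, Finset.mul_sum, Finset.sum_mul]
    exact Finset.sum_congr rfl fun y _ => by ring
  refine (Finset.sum_le_sum fun x _ => Finset.sum_le_sum fun y _ => hterm x y).trans ?_
  have hsplit : ∑ x, ∑ y, (w x * f x * ((f y - f x) * 𝒮.q β x y)
        + η * (k x y * (3 / 2 * f x ^ 2) + k x y * (1 / 2 * f y ^ 2)))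
      = -𝒮.energy β f + η * (∑ x, ∑ y, k x y * (3 / 2 * f x ^ 2)
        + ∑ x, ∑ y, k x y * (1 / 2 * f y ^ 2)) := by
    rw [← henergy]
    simp only [Finset.mul_sum, mul_add, Finset.sum_add_distrib]
  rw [hsplit]
  have := mul_le_mul_of_nonneg_left (add_le_add hfst hsnd) hη
  linarith

end Setting

/-- A probability `N` on `F`, and a reference weight `w`: the second moment of the density. -/
noncomputable def secondMoment {E : Type*} [Fintype E] (N w : E → ℝ) : ℝ := ∑ x, N x ^ 2 / w x

theorem sum_indicator_le_sqrt_mul_sqrt {E : Type*} [Fintype E] {N w : E → ℝ}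
    (hw : ∀ x, 0 ≤ w x) (hNw : ∀ x, w x = 0 → N x = 0) (A : Set E) :
    ∑ x, A.indicator N x ≤ √(secondMoment N w) * √(∑ x, A.indicator w x) := by
  classical
  unfold secondMoment
  rw [← Real.sqrt_mul (Finset.sum_nonneg fun x _ => div_nonneg (sq_nonneg _) (hw x))]
  refine Real.le_sqrt_of_sq_le ?_
  calc _ ≤ (∑ x, A.indicator (fun x => N x ^ 2 / w x) x) * ∑ x, A.indicator w x := by
        refine Finset.sum_sq_le_sum_mul_sum_of_sq_le_mul _
          (fun x _ => Set.indicator_nonneg (fun y _ => div_nonneg (sq_nonneg _) (hw y)) x)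
          (fun x _ => Set.indicator_nonneg (fun y _ => hw y) x) fun x _ => ?_
        by_cases hx : x ∈ A
        · simp only [Set.indicator_of_mem hx]
          by_cases h0 : w x = 0
          · simp [h0, hNw x h0]
          · exact (div_mul_cancel₀ _ h0).ge
        · simp [Set.indicator_of_notMem hx]
    _ ≤ _ := by
        refine mul_le_mul_of_nonneg_right (Finset.sum_le_sum fun x _ => ?_)
          (Finset.sum_nonneg fun x _ => Set.indicator_nonneg (fun y _ => hw y) x)
        exact Set.indicator_le_self' (fun _ _ => div_nonneg (sq_nonneg _) (hw _)) x

namespace Setting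

variable {E Ω : Type*} [Fintype E] [DecidableEq E] [MeasurableSpace Ω] (𝒮 : Setting E Ω)

/-- On `E'` the reference weights lie between `1/K` and `1`; elsewhere both Gibbs weights vanish. -/
theorem gibbsMass_le_mul_gibbsMass_one (hE : 𝒮.E'.Nonempty) (β : ℝ) (A : Set E) :
    𝒮.gibbsMass 𝒮.μ₀ β A ≤ (∑ x, (𝒮.μ₀ x)⁻¹) * 𝒮.gibbsMass (fun _ => 1) β A := by
  set K := ∑ x, (𝒮.μ₀ x)⁻¹ with hK
  have hZ := 𝒮.partition_pos 𝒮.μ₀_nonneg 𝒮.μ₀_pos hE β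
  have hZ1 := 𝒮.partition_pos (w := fun _ => 1) (fun _ => zero_le_one) (fun _ _ => one_pos) hE β
  have hinv : ∀ x ∈ 𝒮.E', 1 ≤ K * 𝒮.μ₀ x := fun x hx => by
    rw [← inv_mul_cancel₀ (𝒮.μ₀_pos x hx).ne']
    exact mul_le_mul_of_nonneg_right (Finset.single_le_sum (f := fun x => (𝒮.μ₀ x)⁻¹)
      (fun y _ => inv_nonneg.mpr (𝒮.μ₀_nonneg y)) (Finset.mem_univ x)) (𝒮.μ₀_nonneg x)
  have hle : 𝒮.partition (fun _ => 1) β ≤ K * 𝒮.partition 𝒮.μ₀ β := by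
    rw [partition, partition, Finset.mul_sum]
    refine Finset.sum_le_sum fun x _ => ?_
    by_cases hx : x ∈ 𝒮.E'
    · rw [← mul_assoc]
      exact mul_le_mul_of_nonneg_right (hinv x hx) (boltz_nonneg _ _)
    · simp [𝒮.boltz_J_eq_zero β hx]
  rw [gibbsMass, gibbsMass, Finset.mul_sum]
  refine Finset.sum_le_sum fun x _ => ?_
  by_cases hx : x ∈ A
  · simp only [Set.indicator_of_mem hx, gibbs_eq, one_mul]
    rw [← mul_div_assoc, div_le_div_iff₀ hZ hZ1]
    have h1 := mul_le_of_le_one_left (boltz_nonneg β (𝒮.J x)) (𝒮.μ₀_le_one x)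
    calc _ ≤ boltz β (𝒮.J x) * (K * 𝒮.partition 𝒮.μ₀ β) :=
          mul_le_mul h1 hle hZ1.le (boltz_nonneg _ _)
      _ = _ := by ring
  · simp [Set.indicator_of_notMem hx]

theorem gibbs_ge {β : ℝ} (hβ : 0 ≤ β) {x : E} (hx : x ∈ 𝒮.E') :
    𝒮.μ₀ x * Real.exp (-(β * 𝒮.M)) ≤ 𝒮.gibbs 𝒮.μ₀ β x := by
  have hZ := 𝒮.partition_pos 𝒮.μ₀_nonneg 𝒮.μ₀_pos ⟨x, hx⟩ β
  have hZ1 : 𝒮.partition 𝒮.μ₀ β ≤ 1 := by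
    rw [← 𝒮.μ₀_sum]
    exact Finset.sum_le_sum fun z _ =>
      mul_le_of_le_one_right (𝒮.μ₀_nonneg z) (boltz_le_one hβ _)
  rw [gibbs_eq, le_div_iff₀ hZ, 𝒮.boltz_J β hx]
  have h1 : Real.exp (-(β * 𝒮.M)) ≤ Real.exp (-(β * 𝒮.cost x)) :=
    Real.exp_le_exp.mpr (neg_le_neg (mul_le_mul_of_nonneg_left (𝒮.cost_le hx) hβ))
  refine (mul_le_of_le_one_right ?_ hZ1).trans (mul_le_mul_of_nonneg_left h1 (𝒮.μ₀_nonneg x))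
  exact mul_nonneg (𝒮.μ₀_nonneg x) (Real.exp_pos _).le

/-- A crude bound for bounded times, from the Gibbs lower bound `gibbs_ge`. Outside `E'` the summand
is `N² / 0 = 0`. -/
theorem secondMoment_le_of_le_one {β β' : ℝ} (hβ : 0 ≤ β) (hββ' : β ≤ β') {N : E → ℝ}
    (hN0 : ∀ x, 0 ≤ N x) (hN1 : ∀ x, N x ≤ 1) :
    secondMoment N (𝒮.gibbs 𝒮.μ₀ β) ≤ ∑ x, (𝒮.μ₀ x * Real.exp (-(β' * 𝒮.M)))⁻¹ := by
  refine Finset.sum_le_sum fun x _ => ?_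
  by_cases hx : x ∈ 𝒮.E'
  · have h0 : 0 < 𝒮.μ₀ x * Real.exp (-(β' * 𝒮.M)) := mul_pos (𝒮.μ₀_pos x hx) (Real.exp_pos _)
    have h1 : 𝒮.μ₀ x * Real.exp (-(β' * 𝒮.M)) ≤ 𝒮.gibbs 𝒮.μ₀ β x := by
      refine le_trans (mul_le_mul_of_nonneg_left (Real.exp_le_exp.mpr ?_) (𝒮.μ₀_nonneg x))
        (𝒮.gibbs_ge hβ hx)
      exact neg_le_neg (mul_le_mul_of_nonneg_right hββ' 𝒮.M_pos.le)
    rw [← one_div]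
    exact div_le_div₀ zero_le_one (pow_le_one₀ (hN0 x) (hN1 x)) h0 h1
  · rw [𝒮.gibbs_eq_zero _ β hx, div_zero]
    exact inv_nonneg.mpr (mul_nonneg (𝒮.μ₀_nonneg x) (Real.exp_pos _).le)

section Evolution

variable {b d α : ℝ} {N : E → ℝ → ℝ}

theorem hasDerivAt_secondMoment (hE : 𝒮.E'.Nonempty) (hNE : ∀ x, x ∉ 𝒮.E' → ∀ t, N x t = 0)
    {N' : E → ℝ} {t : ℝ} (hN : ∀ x, HasDerivAt (N x) (N' x) t) (ht : 0 < t * d + 1) :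
    HasDerivAt (fun t => secondMoment (fun x => N x t) (𝒮.gibbs 𝒮.μ₀ (cooling b d t)))
      (∑ x, (2 * (N x t / 𝒮.gibbs 𝒮.μ₀ (cooling b d t) x) * N' x
        - (N x t / 𝒮.gibbs 𝒮.μ₀ (cooling b d t) x) ^ 2
          * (((𝒮.gibbsCost 𝒮.μ₀ (cooling b d t) - 𝒮.cost x)
            * 𝒮.gibbs 𝒮.μ₀ (cooling b d t) x) * (b * d / (t * d + 1))))) t := by
  unfold secondMoment
  refine HasDerivAt.fun_sum fun x _ => ?_
  by_cases hx : x ∈ 𝒮.E'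
  · have hw := 𝒮.gibbs_pos 𝒮.μ₀_nonneg 𝒮.μ₀_pos (cooling b d t) hx
    have hw' := (𝒮.hasDerivAt_gibbs
      (𝒮.partition_pos 𝒮.μ₀_nonneg 𝒮.μ₀_pos hE (cooling b d t)).ne' x).comp t
      (hasDerivAt_cooling b ht)
    convert! ((hN x).pow 2).div hw' hw.ne' using 1
    simp only [Function.comp_apply]
    field_simp
    simp
    ring
  · simpa [hNE x hx, 𝒮.gibbs_eq_zero _ _ hx] using hasDerivAt_const t (0 : ℝ)

/-- The drift contributes twice the noisy form of the density, hence the gap term and `4 η`. The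
cooling contributes at most `M β'`, since `J x` minus the mean cost is at most `M` on `E'`. -/
theorem deriv_secondMoment_le (hb : 0 ≤ b) (hd : 0 ≤ d) {c m : ℝ} (hPoin : 𝒮.PoincareBound c m)
    (hNE : ∀ x, x ∉ 𝒮.E' → ∀ t, N x t = 0) {t : ℝ} (ht : 0 ≤ t) (hsum : ∑ x, N x t = 1) {η : ℝ}
    (hη : 0 ≤ η) (hacc : ∀ x ∈ 𝒮.E', ∀ y ∈ 𝒮.E',
      |𝒮.accept (cooling b d t) (intensity α t) x y - boltz (cooling b d t) (𝒮.J y - 𝒮.J x)|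
      ≤ boltz (cooling b d t) (𝒮.J y - 𝒮.J x) * η) :
    ∑ x, (2 * (N x t / 𝒮.gibbs 𝒮.μ₀ (cooling b d t) x)
          * (∑ y, 𝒮.noisyKernel b d α t y x * N y t - N x t)
        - (N x t / 𝒮.gibbs 𝒮.μ₀ (cooling b d t) x) ^ 2
          * (((𝒮.gibbsCost 𝒮.μ₀ (cooling b d t) - 𝒮.cost x)
            * 𝒮.gibbs 𝒮.μ₀ (cooling b d t) x) * (b * d / (t * d + 1))))
      ≤ -(2 * (c * Real.exp (-(m * cooling b d t))
          * (secondMoment (fun x => N x t) (𝒮.gibbs 𝒮.μ₀ (cooling b d t)) - 1)))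
        + (b * d * 𝒮.M / (t * d + 1) + 4 * η)
          * secondMoment (fun x => N x t) (𝒮.gibbs 𝒮.μ₀ (cooling b d t)) := by
  set β := cooling b d t with hβ_def
  have hβ : 0 ≤ β := cooling_nonneg hb hd ht
  set w := 𝒮.gibbs 𝒮.μ₀ β with hw
  have hw0 : ∀ x, 0 ≤ w x := 𝒮.gibbs_nonneg 𝒮.μ₀_nonneg β
  set f : E → ℝ := fun x => N x t / w x with hf
  have hfw : ∀ x, N x t = f x * w x := fun x => by
    by_cases hx : x ∈ 𝒮.E'
    · simp only [hf]
      rw [div_mul_cancel₀ _ (𝒮.gibbs_pos 𝒮.μ₀_nonneg 𝒮.μ₀_pos β hx).ne']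
    · rw [hNE x hx, hw, 𝒮.gibbs_eq_zero _ _ hx, mul_zero]
  have hu : secondMoment (fun x => N x t) w = ∑ x, f x ^ 2 * w x := by
    refine Finset.sum_congr rfl fun x _ => ?_
    by_cases hx : w x = 0
    · simp [hx]
    · simp only [hf]
      field_simp
  -- Duality: the forward operator applied to `f w`, tested against `f`, is the generator applied to
  -- `f`, tested against `f w`. The loss term is rewritten using the unit row sums of the kernel.
  have hdrift : ∑ x, 2 * f x * (∑ y, 𝒮.noisyKernel b d α t y x * N y t - N x t)
      = 2 * ∑ x, ∑ y, w x * f x * ((f y - f x) * 𝒮.qTilde β (intensity α t) x y) := by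
    have h1 : ∀ x, ∑ y, w x * f x * ((f y - f x) * 𝒮.qTilde β (intensity α t) x y)
        = ∑ y, w x * f x * f y * 𝒮.qTilde β (intensity α t) x y - w x * f x * f x := fun x => by
      have h2 : w x * f x * f x = ∑ y, w x * f x * f x * 𝒮.qTilde β (intensity α t) x y := by
        rw [← Finset.mul_sum, 𝒮.qTilde_sum, mul_one]
      conv_rhs => rw [h2, ← Finset.sum_sub_distrib]
      exact Finset.sum_congr rfl fun y _ => by ring
    have h3 : ∀ x, 2 * f x * (∑ y, 𝒮.noisyKernel b d α t y x * N y t - N x t)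
        = 2 * ∑ y, w y * f y * f x * 𝒮.qTilde β (intensity α t) y x - 2 * (w x * f x * f x) :=
      fun x => by
        rw [mul_sub, Finset.mul_sum, Finset.mul_sum, hfw x]
        congr 1
        · refine Finset.sum_congr rfl fun y _ => ?_
          rw [hfw y, noisyKernel, max_eq_left ht]
          ring
        · ring
    simp_rw [h1, h3, Finset.sum_sub_distrib, ← Finset.mul_sum]
    rw [Finset.sum_comm]
    ring
  have hf1 : ∑ x, f x * w x = 1 := by rw [← hsum]; exact Finset.sum_congr rfl fun x _ => (hfw x).symm
  have hE := hPoin β hβ f hf1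
  have hnoise := 𝒮.sum_mul_qTilde_le hβ hη hacc f
  have hrate : 0 ≤ b * d / (t * d + 1) := by positivity
  have hcost0 : 0 ≤ 𝒮.gibbsCost 𝒮.μ₀ β :=
    Finset.sum_nonneg fun x _ => mul_nonneg (𝒮.cost_nonneg x) (hw0 x)
  have hcool : -∑ x, f x ^ 2 * (((𝒮.gibbsCost 𝒮.μ₀ β - 𝒮.cost x) * w x) * (b * d / (t * d + 1)))
      ≤ b * d * 𝒮.M / (t * d + 1) * ∑ x, f x ^ 2 * w x := by
    rw [← Finset.sum_neg_distrib, Finset.mul_sum]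
    refine Finset.sum_le_sum fun x _ => ?_
    by_cases hx : x ∈ 𝒮.E'
    · have h1 : 𝒮.cost x - 𝒮.gibbsCost 𝒮.μ₀ β ≤ 𝒮.M := by linarith [𝒮.cost_le hx]
      have h2 := mul_le_mul_of_nonneg_right h1
        (mul_nonneg hrate (mul_nonneg (sq_nonneg (f x)) (hw0 x)))
      calc _ = (𝒮.cost x - 𝒮.gibbsCost 𝒮.μ₀ β)
            * (b * d / (t * d + 1) * (f x ^ 2 * w x)) := by ring
        _ ≤ _ := h2
        _ = _ := by ring
    · simp [hw, 𝒮.gibbs_eq_zero _ _ hx]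
  rw [Finset.sum_sub_distrib, hdrift, hu]
  rw [← hw] at hE hnoise
  linarith

/-- If the cooling and the noise are eventually dominated by the spectral gap, the second moment
of the density stays bounded. -/
theorem exists_secondMoment_le (hE : 𝒮.E'.Nonempty) (hb : 0 ≤ b) (hd : 0 ≤ d) {c m : ℝ}
    (hc : 0 < c) (hPoin : 𝒮.PoincareBound c m)
    (hN : ∀ x t, 0 < t → HasDerivAt (N x) (∑ y, 𝒮.noisyKernel b d α t y x * N y t - N x t) t)
    (hNE : ∀ x, x ∉ 𝒮.E' → ∀ t, N x t = 0) (hN0 : ∀ x t, 0 ≤ N x t)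
    (hN1 : ∀ t, 0 ≤ t → ∑ x, N x t = 1) {ρ : ℝ} (hρ : ρ < 1)
    (hdom : ∀ᶠ t in atTop, b * d * 𝒮.M / (t * d + 1)
      + 4 * 𝒮.acceptError (cooling b d t) (intensity α t)
      ≤ 2 * ρ * (c * Real.exp (-(m * cooling b d t)))) :
    ∃ K : ℝ, 0 < K ∧ ∀ t, 0 ≤ t →
      secondMoment (fun x => N x t) (𝒮.gibbs 𝒮.μ₀ (cooling b d t)) ≤ K := by
  obtain ⟨t₀, ht₀⟩ := eventually_atTop.mp (hdom.and (eventually_gt_atTop 0))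
  have ht₀pos : 0 < t₀ := (ht₀ t₀ le_rfl).2
  set K₀ := ∑ x, (𝒮.μ₀ x * Real.exp (-(cooling b d t₀ * 𝒮.M)))⁻¹ with hK₀
  have hNle : ∀ x t, 0 ≤ t → N x t ≤ 1 := fun x t ht => by
    rw [← hN1 t ht]
    exact Finset.single_le_sum (f := fun x => N x t) (fun y _ => hN0 y t) (Finset.mem_univ x)
  have hearly : ∀ t, 0 ≤ t → t ≤ t₀ →
      secondMoment (fun x => N x t) (𝒮.gibbs 𝒮.μ₀ (cooling b d t)) ≤ K₀ := fun t ht htt₀ =>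
    𝒮.secondMoment_le_of_le_one (cooling_nonneg hb hd ht) (cooling_mono hb hd ht htt₀)
      (fun x => hN0 x t) fun x => hNle x t ht
  have hK₀0 : 0 ≤ K₀ := Finset.sum_nonneg fun x _ =>
    inv_nonneg.mpr (mul_nonneg (𝒮.μ₀_nonneg x) (Real.exp_pos _).le)
  -- `K₀` covers the times up to `t₀`. When `u = K` the derivative is at most `2κ(1 - (1 - ρ)K)`,
  -- negative as soon as `K > 1/(1 - ρ)`.
  set K := max K₀ (1 / (1 - ρ)) + 1 with hK
  have hK0 : 0 < K := by have := hK₀0.trans (le_max_left K₀ (1 / (1 - ρ))); linarith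
  refine ⟨K, hK0, fun t ht => ?_⟩
  rcases le_total t t₀ with h | h
  · exact (hearly t ht h).trans ((le_max_left _ _).trans (by linarith))
  have hderiv : ∀ s : ℝ, 0 < s → _ := fun s hs =>
    𝒮.hasDerivAt_secondMoment (b := b) (d := d) hE hNE (fun x => hN x s hs)
      (add_pos_of_nonneg_of_pos (mul_nonneg hs.le hd) one_pos)
  -- Barrier argument: a strictly negative derivative is needed only at the times when `u = K`.
  refine image_le_of_deriv_right_lt_deriv_boundary (a := t₀) (b := t) (B := fun _ => K)
    (B' := fun _ => 0)
    (fun s hs => (hderiv s (ht₀pos.trans_le hs.1)).continuousAt.continuousWithinAt)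
    (fun s hs => (hderiv s (ht₀pos.trans_le hs.1)).hasDerivWithinAt)
    ((hearly t₀ ht₀pos.le le_rfl).trans ((le_max_left _ _).trans (by linarith)))
    (fun s => hasDerivAt_const s K) (fun s hs heq => ?_) ⟨h, le_rfl⟩
  have hs0 : 0 < s := ht₀pos.trans_le hs.1
  have hr : 0 < intensity α s := by
    rw [intensity, Real.toNNReal_pos]
    positivity
  have hη : 0 ≤ 𝒮.acceptError (cooling b d s) (intensity α s) := by
    have := cooling_nonneg hb hd hs0.le
    have := 𝒮.M_pos
    unfold acceptError relError
    positivity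
  have hle := 𝒮.deriv_secondMoment_le (α := α) hb hd hPoin hNE hs0.le (hN1 s hs0.le) hη
    fun x hx y hy => 𝒮.abs_accept_sub_le (cooling_nonneg hb hd hs0.le) hr hx hy
  refine hle.trans_lt ?_
  have hdom' := (ht₀ s hs.1).1
  rw [heq]
  set κ := c * Real.exp (-(m * cooling b d s)) with hκ
  have hκ0 : 0 < κ := by positivity
  have hKρ : 1 < (1 - ρ) * K := by
    have h1 : 0 < 1 - ρ := by linarith
    have h2 : 1 / (1 - ρ) < K := by linarith [le_max_right K₀ (1 / (1 - ρ))]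
    rw [div_lt_iff₀ h1] at h2
    linarith
  have h3 := mul_le_mul_of_nonneg_right hdom' hK0.le
  have h4 := mul_lt_mul_of_pos_left hKρ hκ0
  linarith

end Evolution

end Setting

end NoisyAnnealing
-- Asymptotic comparison of spectral gap, cooling and noise.
namespace NoisyAnnealing

open Filter Topology

theorem coe_intensity {α t : ℝ} (ht : 0 ≤ t) : (intensity α t : ℝ) = (t + 1) ^ α :=
  Real.coe_toNNReal _ (by positivity)

theorem tendsto_mul_add_one {d : ℝ} (hd : 0 < d) : Tendsto (fun t : ℝ => t * d + 1) atTop atTop :=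
  tendsto_atTop_add_const_right _ _ (tendsto_id.atTop_mul_const hd)

theorem tendsto_log_div_rpow {r : ℝ} (hr : 0 < r) :
    Tendsto (fun v : ℝ => Real.log v / v ^ r) atTop (𝓝 0) :=
  (isLittleO_log_rpow_atTop hr).tendsto_div_nhds_zero

theorem exists_mul_le_add_one {d : ℝ} (hd : 0 < d) :
    ∃ κ : ℝ, 0 < κ ∧ ∀ t : ℝ, 0 ≤ t → κ * (t * d + 1) ≤ t + 1 := by
  refine ⟨(d + 1)⁻¹, by positivity, fun t ht => ?_⟩
  rw [inv_mul_le_iff₀ (by positivity)]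
  nlinarith [mul_nonneg ht hd.le]

namespace Setting

variable {E Ω : Type*} [Fintype E] [DecidableEq E] [MeasurableSpace Ω] (𝒮 : Setting E Ω)

/-- Since `t + 1 ≥ κ (t d + 1)`, everything is expressed in `v = t d + 1` and bounded by a multiple
of `log v / v^{α/2 - p}`. -/
theorem tendsto_noise_mul_rpow {b d α p : ℝ} (hb : 0 < b) (hd : 0 < d) (hp : p < α / 2)
    (hα : 0 < α) : Tendsto (fun t => 2 * (cooling b d t * 𝒮.M) / √(intensity α t : ℝ)
      * (t * d + 1) ^ p) atTop (𝓝 0) := by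
  obtain ⟨κ, hκ, hκt⟩ := exists_mul_le_add_one hd
  have hM := 𝒮.M_pos
  have hlim : Tendsto (fun t : ℝ => 2 * b * 𝒮.M / κ ^ (α / 2)
      * (Real.log (t * d + 1) / (t * d + 1) ^ (α / 2 - p))) atTop (𝓝 0) := by
    simpa using ((tendsto_log_div_rpow (sub_pos.mpr hp)).comp
      (tendsto_mul_add_one hd)).const_mul (2 * b * 𝒮.M / κ ^ (α / 2))
  refine squeeze_zero' ?_ ?_ hlim
  · filter_upwards [eventually_ge_atTop 0] with t ht
    have := cooling_nonneg hb.le hd.le ht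
    positivity
  · filter_upwards [eventually_ge_atTop 0] with t ht
    have hv : 0 < t * d + 1 := by positivity
    have hlog : 0 ≤ Real.log (t * d + 1) := Real.log_nonneg (by nlinarith [mul_nonneg ht hd.le])
    have hsqrt : √(intensity α t : ℝ) = (t + 1) ^ (α / 2) := by
      rw [coe_intensity ht, Real.sqrt_eq_rpow, ← Real.rpow_mul (by positivity)]
      ring_nf
    have hle : κ ^ (α / 2) * (t * d + 1) ^ (α / 2) ≤ (t + 1) ^ (α / 2) := by
      rw [← Real.mul_rpow hκ.le hv.le]
      exact Real.rpow_le_rpow (by positivity) (hκt t ht) (by positivity)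
    rw [hsqrt, cooling, Real.rpow_sub hv]
    calc _ ≤ 2 * (b * Real.log (t * d + 1) * 𝒮.M)
          / (κ ^ (α / 2) * (t * d + 1) ^ (α / 2)) * (t * d + 1) ^ p := by gcongr
      _ = _ := by field_simp

/-- The exponent is at most `(b M + p) log v - κ^α v^α / 4`: a stretched exponential beats every
power. -/
theorem tendsto_exp_mul_rpow {b d α p : ℝ} (hd : 0 < d) (hα : 0 < α) :
    Tendsto (fun t => Real.exp (cooling b d t * 𝒮.M - intensity α t / 4) * (t * d + 1) ^ p)
      atTop (𝓝 0) := by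
  obtain ⟨κ, hκ, hκt⟩ := exists_mul_le_add_one hd
  have hlim : Tendsto (fun v : ℝ => v ^ α * ((b * 𝒮.M + p) * (Real.log v / v ^ α) - κ ^ α / 4))
      atTop atBot := by
    refine (tendsto_rpow_atTop hα).atTop_mul_neg (C := -(κ ^ α / 4))
      (neg_lt_zero.mpr (by positivity)) ?_
    simpa using ((tendsto_log_div_rpow hα).const_mul (b * 𝒮.M + p)).sub_const (κ ^ α / 4)
  refine squeeze_zero' ?_ ?_ (Real.tendsto_exp_atBot.comp (hlim.comp (tendsto_mul_add_one hd)))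
  · filter_upwards [eventually_ge_atTop 0] with t ht
    positivity
  · filter_upwards [eventually_ge_atTop 0] with t ht
    have hv : 0 < t * d + 1 := by positivity
    have hle : κ ^ α * (t * d + 1) ^ α ≤ (t + 1) ^ α := by
      rw [← Real.mul_rpow hκ.le hv.le]
      exact Real.rpow_le_rpow (by positivity) (hκt t ht) hα.le
    rw [coe_intensity ht, cooling, Real.rpow_def_of_pos hv p, ← Real.exp_add]
    refine Real.exp_le_exp.mpr ?_
    have hva : (t * d + 1) ^ α ≠ 0 := (Real.rpow_pos_of_pos hv α).ne'
    calc _ ≤ b * Real.log (t * d + 1) * 𝒮.M - κ ^ α * (t * d + 1) ^ α / 4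
          + Real.log (t * d + 1) * p := by gcongr
      _ = _ := by simp only [Function.comp_apply]; field_simp; ring

theorem tendsto_acceptError_mul_rpow {b d α p : ℝ} (hb : 0 < b) (hd : 0 < d) (hp : p < α / 2)
    (hα : 0 < α) : Tendsto (fun t => 𝒮.acceptError (cooling b d t) (intensity α t)
      * (t * d + 1) ^ p) atTop (𝓝 0) := by
  have h0 : Tendsto (fun t => 2 * (cooling b d t * 𝒮.M) / √(intensity α t : ℝ)) atTop (𝓝 0) := by
    simpa using 𝒮.tendsto_noise_mul_rpow (p := 0) hb hd (by positivity) hα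
  have h1 := (((𝒮.tendsto_noise_mul_rpow hb hd hp hα).const_mul 2).mul
    (((((h0.const_add 1).pow 2).div_const 2)).rexp)).add (𝒮.tendsto_exp_mul_rpow (b := b) (p := p) hd hα)
  simp only [mul_zero, zero_mul, add_zero] at h1
  refine h1.congr fun t => ?_
  rw [acceptError, relError]
  ring

/-- The cooling and the noise are eventually dominated by the spectral gap. -/
theorem eventually_dominated {b d α p m c l : ℝ} (hb : 0 < b) (hd : 0 < d) (hp : p < α / 2)
    (hα : 0 < α) (hm : m * b = p) (hc : 0 < c) (hl : l < 2 * c)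
    (hlim : Tendsto (fun t => b * d * 𝒮.M / (t * d + 1) * (t * d + 1) ^ p) atTop (𝓝 l)) :
    ∃ ρ < 1, ∀ᶠ t in atTop, b * d * 𝒮.M / (t * d + 1)
      + 4 * 𝒮.acceptError (cooling b d t) (intensity α t)
      ≤ 2 * ρ * (c * Real.exp (-(m * cooling b d t))) := by
  -- Multiplied by `v^p`, the gap term is the constant `2ρc` and the perturbations tend to `l`. Any
  -- `r` strictly between `l` and `2c` leaves room, with `ρ = r / (2c)`.
  obtain ⟨r, hlr, hr⟩ := exists_between hl
  refine ⟨r / (2 * c), (div_lt_one (by positivity)).mpr hr, ?_⟩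
  have h1 := hlim.add ((𝒮.tendsto_acceptError_mul_rpow hb hd hp hα).const_mul 4)
  rw [mul_zero, add_zero] at h1
  filter_upwards [h1.eventually_lt_const hlr, eventually_ge_atTop 0] with t h2 ht
  have hv : 0 < t * d + 1 := by positivity
  have hvp := Real.rpow_pos_of_pos hv p
  rw [exp_neg_mul_cooling m b hv, hm, Real.rpow_neg hv.le]
  have h3 : 2 * (r / (2 * c)) * (c * ((t * d + 1) ^ p)⁻¹) = r / (t * d + 1) ^ p := by
    field_simp
  rw [h3, le_div_iff₀ hvp]
  linarith

theorem tendsto_coolingRate_mul_rpow {b d p : ℝ} (hd : 0 < d) (hp : p < 1) :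
    Tendsto (fun t => b * d * 𝒮.M / (t * d + 1) * (t * d + 1) ^ p) atTop (𝓝 0) := by
  have h1 := ((tendsto_rpow_neg_atTop (sub_pos.mpr hp)).comp
    (tendsto_mul_add_one hd)).const_mul (b * d * 𝒮.M)
  rw [mul_zero] at h1
  refine h1.congr' ?_
  filter_upwards [eventually_ge_atTop 0] with t ht
  have hv : 0 < t * d + 1 := by positivity
  rw [Function.comp_apply, neg_sub, Real.rpow_sub_one hv.ne']
  ring

/-- The process is controlled by the Gibbs distribution as soon as a Poincaré inequality
dominates the cooling and the noise. -/
theorem exists_measure_le {b d α : ℝ} (hb : 0 ≤ b) (hd : 0 ≤ d) {c m : ℝ}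
    (hc : 0 < c) (hPoin : 𝒮.PoincareBound c m)
    (hdom : ∃ ρ < 1, ∀ᶠ t in atTop, b * d * 𝒮.M / (t * d + 1)
      + 4 * 𝒮.acceptError (cooling b d t) (intensity α t)
      ≤ 2 * ρ * (c * Real.exp (-(m * cooling b d t)))) (hE : 𝒮.E'.Nonempty)
    {Ω' : Type*} [MeasurableSpace Ω'] {Pr : Measure Ω'} [IsProbabilityMeasure Pr]
    {χ : ℕ → Ω' → E} {T : ℕ → Ω' → ℝ} {X : ℝ → Ω' → E} (hX : IsNSA 𝒮 b d α Pr χ T X) :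
    ∃ C : ℝ, 0 < C ∧ ∀ t : ℝ, 0 ≤ t → ∀ A : Set E,
      Pr.real {ω | X t ω ∈ A} ≤ C * √(𝒮.gibbsMass 𝒮.μ₀ (cooling b d t) A) := by
  obtain ⟨ρ, hρ, hdom⟩ := hdom
  have h := 𝒮.isJumpChain hb hd hX
  set N : E → ℝ → ℝ := fun x t => (IsJumpChain.law Pr χ T x t).toReal with hN
  have hNE : ∀ x, x ∉ 𝒮.E' → ∀ t, N x t = 0 := fun x hx t => by
    simp only [hN]
    rw [h.law_eq_zero hX.start_mem (fun τ x y hx hy => 𝒮.qTilde_eq_zero _ _ hx hy) hx t,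
      ENNReal.toReal_zero]
  have hfin : ∀ x t, 0 ≤ t → IsJumpChain.law Pr χ T x t ≠ ⊤ := fun x t ht =>
    ne_top_of_le_ne_top ENNReal.one_ne_top (h.law_le_one x ht)
  have hN1 : ∀ t, 0 ≤ t → ∑ x, N x t = 1 := fun t ht => by
    simp only [hN]
    rw [← ENNReal.toReal_sum fun x _ => hfin x t ht, h.sum_law ht, ENNReal.toReal_one]
  obtain ⟨K, hK, hKle⟩ := 𝒮.exists_secondMoment_le hE hb hd hc hPoin
    (fun x t ht => h.hasDerivAt_law x ht) hNE (fun x t => ENNReal.toReal_nonneg) hN1 hρ hdom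
  refine ⟨√K, Real.sqrt_pos.mpr hK, fun t ht A => ?_⟩
  have h1 : Pr.real {ω | X t ω ∈ A} ≤ ∑ x, A.indicator (fun x => N x t) x := by
    have h2 := h.measure_process_le hX.process ht A
    have h3 : ∀ x, A.indicator (fun x => IsJumpChain.law Pr χ T x t) x ≠ ⊤ := fun x =>
      ne_top_of_le_ne_top (hfin x t ht) (Set.indicator_le_self _ _ x)
    have h4 := ENNReal.toReal_mono (ENNReal.sum_ne_top.mpr fun x _ => h3 x) h2
    rw [ENNReal.toReal_sum fun x _ => h3 x] at h4
    refine h4.trans (le_of_eq (Finset.sum_congr rfl fun x _ => ?_))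
    by_cases hx : x ∈ A <;> simp [hx, hN]
  refine h1.trans ((sum_indicator_le_sqrt_mul_sqrt (w := 𝒮.gibbs 𝒮.μ₀ (cooling b d t))
    (𝒮.gibbs_nonneg 𝒮.μ₀_nonneg _) (fun x hx => ?_) A).trans ?_)
  · refine hNE x (fun hx' => ?_) t
    exact (𝒮.gibbs_pos 𝒮.μ₀_nonneg 𝒮.μ₀_pos _ hx').ne' hx
  · exact mul_le_mul_of_nonneg_right (Real.sqrt_le_sqrt (hKle t ht)) (Real.sqrt_nonneg _)

end Setting

end NoisyAnnealing

/-! ### The two parameter regimes and the conclusion. -/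

theorem mainTheorem1 {E : Type*} [Fintype E] [DecidableEq E] {Ω : Type*} [MeasurableSpace Ω]
    (𝒮 : NoisyAnnealing.Setting E Ω) (b d α : ℝ) (hb : 0 < b) (hd : 0 < d)
    (hpar : 𝒮.mStar * ENNReal.ofReal b < ENNReal.ofReal (min 1 (α / 2)) ∨
      (𝒮.mStar * ENNReal.ofReal b = 1 ∧ 2 < α ∧
        ∃ c : ℝ, (∀ β : ℝ, 0 ≤ β → c * Real.exp (-(𝒮.mStar.toReal * β)) ≤ 𝒮.gap β) ∧
          d < 2 * c * 𝒮.mStar.toReal / 𝒮.M))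
    {Ω' : Type*} [MeasurableSpace Ω'] (Pr : Measure Ω') [IsProbabilityMeasure Pr]
    (χ : ℕ → Ω' → E) (T : ℕ → Ω' → ℝ) (X : ℝ → Ω' → E)
    (hX : NoisyAnnealing.IsNSA 𝒮 b d α Pr χ T X) :
    ∃ C : ℝ, 0 < C ∧ ∀ t : ℝ, 0 ≤ t → ∀ ε : ℝ, 0 < ε →
      Pr.real {ω | X t ω ∈ (𝒮.optimalSet ε)ᶜ} ≤
          C * Real.sqrt (𝒮.gibbsMass 𝒮.μ₀ (NoisyAnnealing.cooling b d t) (𝒮.optimalSet ε)ᶜ) ∧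
        Pr.real {ω | X t ω ∈ (𝒮.optimalSet ε)ᶜ} ≤
          C * Real.sqrt (𝒮.gibbsMass (fun _ => 1) (NoisyAnnealing.cooling b d t)
            (𝒮.optimalSet ε)ᶜ) := by
  have hE : 𝒮.E'.Nonempty := by
    obtain ⟨ω, hω⟩ := hX.start_mem.exists
    exact ⟨_, hω⟩
  have hM := 𝒮.M_pos
  have hbpos : ENNReal.ofReal b ≠ 0 := (ENNReal.ofReal_pos.mpr hb).ne'
  have hmain : ∃ C : ℝ, 0 < C ∧ ∀ t : ℝ, 0 ≤ t → ∀ A : Set E,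
      Pr.real {ω | X t ω ∈ A}
        ≤ C * √(𝒮.gibbsMass 𝒮.μ₀ (NoisyAnnealing.cooling b d t) A) := by
    rcases hpar with hpar | ⟨hpar, hα, c, hgap, hdc⟩
    -- Case (i): `p = m⋆ b < 1`, so the cooling is negligible against the gap and the limit `l` is
    -- `0`. The strict inequality in `[0, ∞]` also forces `m⋆ < ∞` and `α > 0`.
    · have hm : 𝒮.mStar ≠ ⊤ := fun hm => by simp [hm, ENNReal.top_mul hbpos] at hpar
      rw [← ENNReal.ofReal_toReal hm, ← ENNReal.ofReal_mul ENNReal.toReal_nonneg,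
        ENNReal.ofReal_lt_ofReal_iff', lt_min_iff, lt_min_iff] at hpar
      obtain ⟨⟨hp1, hpα⟩, -, hα⟩ := hpar
      obtain ⟨c, hc, hPoin⟩ := 𝒮.exists_poincareBound hE hm
      exact 𝒮.exists_measure_le hb.le hd.le hc hPoin (𝒮.eventually_dominated hb hd hpα
        (by linarith) rfl hc (by positivity) (𝒮.tendsto_coolingRate_mul_rpow hd hp1)) hE hX
    · have hm : 𝒮.mStar.toReal * b = 1 := by
        have := congrArg ENNReal.toReal hpar
        rwa [ENNReal.toReal_mul, ENNReal.toReal_ofReal hb.le, ENNReal.toReal_one] at this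
      have hm0 : 0 < 𝒮.mStar.toReal := pos_of_mul_pos_left (hm ▸ one_pos) hb.le
      rw [lt_div_iff₀ hM] at hdc
      have hc : 0 < c := by
        have h1 : 0 < 2 * c * 𝒮.mStar.toReal := (mul_pos hd hM).trans hdc
        have h2 := pos_of_mul_pos_left h1 hm0.le
        linarith
      -- Case (ii): multiplying `d M < 2 c m⋆` by `b` and using `m⋆ b = 1`. Here `p = 1`, and the
      -- rescaled cooling rate is the constant `l = b d M`.
      have hl : b * d * 𝒮.M < 2 * c := by
        have := mul_lt_mul_of_pos_right hdc hb
        rw [mul_assoc (2 * c), hm] at this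
        linarith
      refine 𝒮.exists_measure_le hb.le hd.le hc (𝒮.poincareBound_of_le_gap hE hgap)
        (𝒮.eventually_dominated hb hd (p := 1) (by linarith) (by linarith) hm hc hl ?_) hE hX
      refine Filter.Tendsto.congr' ?_ tendsto_const_nhds
      filter_upwards [Filter.eventually_ge_atTop 0] with t ht
      have hv : 0 < t * d + 1 := by positivity
      rw [Real.rpow_one, div_mul_cancel₀ _ hv.ne']
  obtain ⟨C, hC, hle⟩ := hmain
  have hK : 0 ≤ ∑ x, (𝒮.μ₀ x)⁻¹ := Finset.sum_nonneg fun x _ => inv_nonneg.mpr (𝒮.μ₀_nonneg x)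
  -- One constant serves both Gibbs measures: the factor `1` is for the weights `μ₀`, the root for
  -- the passage to unit weights.
  refine ⟨C * max 1 √(∑ x, (𝒮.μ₀ x)⁻¹), by positivity, fun t ht ε _ => ⟨?_, ?_⟩⟩
  · refine (hle t ht _).trans (mul_le_mul_of_nonneg_right ?_ (Real.sqrt_nonneg _))
    exact le_mul_of_one_le_right hC.le (le_max_left _ _)
  · refine (hle t ht _).trans ?_
    rw [mul_assoc]
    refine mul_le_mul_of_nonneg_left ?_ hC.le
    refine (Real.sqrt_le_sqrt (𝒮.gibbsMass_le_mul_gibbsMass_one hE _ _)).trans ?_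
    rw [Real.sqrt_mul hK]
    exact mul_le_mul_of_nonneg_right (le_max_right _ _) (Real.sqrt_nonneg _)
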